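/- Let $\mathcal{S}$ be the $\mathbb{Q}$-algebra of formal power series of bounded degree in variables $x_1,x_2,\ldots$ and $\theta_1,\theta_2,\ldots$ subject to the relations $x_i\theta_j=\theta_jx_i$ and $\theta_i\theta_j=-\theta_j\theta_i$ for all $i,j\geq1$. A *partial set supercomposition* of bidegree $(n,m)$ is a tuple $K=(K_1,\ldots,K_r)$ of nonempty subsets (blocks) of $\{0,1,\ldots,n\}$, with $r\geq m$, such that $\{1,\ldots,n\}\subseteq K_1\cup\cdots\cup K_r\subseteq\{0,\ldots,n\}$, $K_i\cap K_j\subseteq\{0\}$ for $i\neq j$, $0\in K_i$ if and only if $i\leq m$, and $\min K_i<\min K_j$ for $m<i<j\leq r$ (the block $\{0\}$ may be repeated). It is a *set superpartition* if moreover $K_i\neq K_j$ and $\min(K_i\setminus K_j)<\min(K_j\setminus K_i)$ for all $i<j$, where $\min\emptyset:=0$. The *over product* of $K$, of bidegree $(n,m)$, with $L$, of bidegree $(p,q)$, is the partial set supercomposition $K/L$ of bidegree $(n+p,m+q)$ whose blocks are, in this order, the first $m$ blocks of $K$, the first $q$ blocks of $L[n]$, the remaining blocks of $K$ and the remaining blocks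 of $L[n]$, where $L[n]$ is obtained from $L$ by adding $n$ to every nonzero element of every block. For $K,L$ of bidegree $(n,m)$ write $K\sqsubseteq L$ if, for each $i\leq m$, the block $L_i$ is the union of $K_i$ with some blocks of $K$ not containing $0$, and each block of $L$ not containing $0$ is a union of blocks of $K$ not containing $0$. This is a partial order in which any two elements have a meet $K\sqcap L$. For $K$ of bidegree $(n,m)$, consider monomials $u=\theta_{a_1}\cdots\theta_{a_m}x_{b_1}\cdots x_{b_n}$ given by words $(a_1,\ldots,a_m,b_1,\ldots,b_n)$ of positive integers, and define the following elements of $\mathcal{S}$: - $p_K$ is the sum of all $u$ such that $a_i=b_j$ whenever $j\in K_i\setminus\{0\}$, $i\leq m$, and $b_i=b_j$ whenever $i,j\in\{1,\ldots,n\}$ belong to the same block of $K$. - $e_K$ is the sum of all $u$ such that $a_i\neq b_j$ whenever $j\in K_i\setminus\{0\}$, $i\leq m$, and $b_i\neq b_j$ whenever $i\neq j$ in $\{1,\ldots,n\}$ belong to the same block of $K$. - $h_K=\sum_u c_u\,u$, over the $u$ with $a_1,\ldots,a_m$ distinct and $\{a_1,\ldots,a_m\}\setminus\{b_1,\ldots,b_n\}$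 having at most one element. Here $c_u=\prod_B|B|!$ over all blocks $B$ of $K\sqcap L$ (the element $0$ being counted in $|B|$), where $L$ is the unique partial set supercomposition of bidegree $(n,m)$ such that $a_i=b_j\iff j\in L_i\setminus\{0\}$ for all $i\leq m$, $j\leq n$, and $b_i=b_j$ if and only if $i,j$ belong to the same block of $L$, for all $i,j\leq n$. Then for all set superpartitions $I$ of bidegree $(n,m)$ and $J$ of bidegree $(p,q)$, with $n,m,p,q\geq0$, \[p_Ip_J=p_{I/J},\qquad e_Ie_J=e_{I/J},\qquad h_Ih_J=h_{I/J}.\] -/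

import Mathlib

namespace Superspace

/-- Formal series of bounded degree. Every monomial in the variables `x_i` and `θ_i` is, up to sign,
zero or `θ_{s_1} ⋯ θ_{s_r} x_{w_1} ⋯ x_{w_k}` with `s_1 < ⋯ < s_r`; the value at `(S, w)` is the
coefficient of this monomial for `S = {s_1, …, s_r}` and `w = [w_1, …, w_k]`. -/
def boundedSeries : Submodule ℚ (Finset ℕ+ → List ℕ+ → ℚ) where
  carrier := {f | ∃ d : ℕ, ∀ S w, f S w ≠ 0 → S.card + w.length ≤ d}
  zero_mem' := ⟨0, fun S w h => absurd rfl h⟩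
  add_mem' := by
    rintro f g ⟨c, hc⟩ ⟨d, hd⟩
    refine ⟨max c d, fun S w h => ?_⟩
    by_cases hf : f S w = 0
    · exact (hd S w fun hg => h (by simp [hf, hg])).trans (le_max_right _ _)
    · exact (hc S w hf).trans (le_max_left _ _)
  smul_mem' := by
    rintro r f ⟨c, hc⟩
    exact ⟨c, fun S w h => hc S w fun hf => h (by simp [hf])⟩

/-- The algebra of functions in noncommuting variables in superspace: formal power series of bounded
degree in `x_1, x_2, …` and `θ_1, θ_2, …` over `ℚ`, with `x_i θ_j = θ_j x_i` and
`θ_i θ_j = - θ_j θ_i`. -/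
def SSeries : Type := boundedSeries

namespace SSeries

instance : AddCommGroup SSeries := inferInstanceAs (AddCommGroup boundedSeries)
instance : Module ℚ SSeries := inferInstanceAs (Module ℚ boundedSeries)

/-- The coefficient of a normal form monomial. -/
def coeff (f : SSeries) (S : Finset ℕ+) (w : List ℕ+) : ℚ := f.1 S w

@[ext] theorem ext {f g : SSeries} (h : ∀ S w, f.coeff S w = g.coeff S w) : f = g :=
  Subtype.ext (funext fun S => funext fun w => h S w)

@[simp] theorem coeff_zero (S w) : (0 : SSeries).coeff S w = 0 := rfl
@[simp] theorem coeff_add (f g : SSeries) (S w) :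
    (f + g).coeff S w = f.coeff S w + g.coeff S w := rfl
@[simp] theorem coeff_smul (r : ℚ) (f : SSeries) (S w) :
    (r • f).coeff S w = r * f.coeff S w := rfl

/-- The sign `(-1)^{#{(s, t) ∈ A × B | t < s}}` that sorts `θ_A θ_B`, where `θ_A` is the product of
the `θ_s`, `s ∈ A`, in increasing order. -/
def sgn (A B : Finset ℕ+) : ℚ := (-1) ^ ((A ×ˢ B).filter fun t => t.2 < t.1).card

theorem sgn_union_left {A B : Finset ℕ+} (h : Disjoint A B) (C : Finset ℕ+) :
    sgn (A ∪ B) C = sgn A C * sgn B C := by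
  unfold sgn
  rw [Finset.union_product, Finset.filter_union, Finset.card_union_of_disjoint, pow_add]
  exact Finset.disjoint_filter_filter (Finset.disjoint_product.2 (Or.inl h))

theorem sgn_union_right {B C : Finset ℕ+} (h : Disjoint B C) (A : Finset ℕ+) :
    sgn A (B ∪ C) = sgn A B * sgn A C := by
  unfold sgn
  rw [Finset.product_union, Finset.filter_union, Finset.card_union_of_disjoint, pow_add]
  exact Finset.disjoint_filter_filter (Finset.disjoint_product.2 (Or.inr h))

@[simp] theorem sgn_empty_left (A : Finset ℕ+) : sgn ∅ A = 1 := by simp [sgn]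
@[simp] theorem sgn_empty_right (A : Finset ℕ+) : sgn A ∅ = 1 := by simp [sgn]

/-- The coefficients of a product, from `θ_A u θ_B v = sgn A B θ_{A ∪ B} u v` for `A ∩ B = ∅`. -/
def mulCoeff (f g : SSeries) (S : Finset ℕ+) (w : List ℕ+) : ℚ :=
  ∑ T ∈ S.powerset, ∑ i ∈ Finset.range (w.length + 1),
    sgn T (S \ T) * f.coeff T (w.take i) * g.coeff (S \ T) (w.drop i)

theorem mulCoeff_mem (f g : SSeries) : mulCoeff f g ∈ boundedSeries := by
  obtain ⟨c, hc⟩ := f.2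
  obtain ⟨d, hd⟩ := g.2
  refine ⟨c + d, fun S w h => ?_⟩
  obtain ⟨T, hT, h⟩ := Finset.exists_ne_zero_of_sum_ne_zero h
  obtain ⟨i, hi, h⟩ := Finset.exists_ne_zero_of_sum_ne_zero h
  have h1 := hc T (w.take i) (right_ne_zero_of_mul (left_ne_zero_of_mul h))
  have h2 := hd (S \ T) (w.drop i) (right_ne_zero_of_mul h)
  have h3 := Finset.card_sdiff_add_card_eq_card (Finset.mem_powerset.1 hT)
  simp only [List.length_take, List.length_drop, Finset.mem_range] at h1 h2 hi
  omega

instance : Mul SSeries := ⟨fun f g => ⟨mulCoeff f g, mulCoeff_mem f g⟩⟩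

theorem coeff_mul (f g : SSeries) (S w) : (f * g).coeff S w =
    ∑ T ∈ S.powerset, ∑ i ∈ Finset.range (w.length + 1),
      sgn T (S \ T) * f.coeff T (w.take i) * g.coeff (S \ T) (w.drop i) := rfl

/-- The normal form monomial `θ_A x_{v_1} ⋯ x_{v_k}` with coefficient `1`. -/
def single (A : Finset ℕ+) (v : List ℕ+) : SSeries :=
  ⟨fun S w => if S = A ∧ w = v then 1 else 0, A.card + v.length, fun S w h => by
    have h' : S = A ∧ w = v := by by_contra hh; exact h (if_neg hh)
    rw [h'.1, h'.2]⟩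

theorem coeff_single (A v S w) :
    (single A v).coeff S w = if S = A ∧ w = v then 1 else 0 := rfl

instance : One SSeries := ⟨single ∅ []⟩

theorem coeff_one (S w) : (1 : SSeries).coeff S w = if S = ∅ ∧ w = [] then 1 else 0 := rfl

protected theorem one_mul (f : SSeries) : 1 * f = f := by
  ext S w
  rw [coeff_mul, Finset.sum_eq_single ∅, Finset.sum_eq_single 0]
  · simp [coeff_one]
  · intro i hi h0
    rw [coeff_one, if_neg]
    · simp
    · rintro ⟨-, h⟩
      simp only [Finset.mem_range] at hi
      have := congrArg List.length h
      rw [List.length_take, List.length_nil] at this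
      omega
  · simp
  · intro T _ hT
    simp [coeff_one, hT]
  · simp

protected theorem mul_one (f : SSeries) : f * 1 = f := by
  ext S w
  rw [coeff_mul, Finset.sum_eq_single S, Finset.sum_eq_single w.length]
  · simp [coeff_one]
  · intro i hi h0
    rw [coeff_one, if_neg]
    · simp
    · rintro ⟨-, h⟩
      simp only [Finset.mem_range] at hi
      have := congrArg List.length h
      simp at this
      omega
  · simp
  · intro T h hT
    rw [Finset.mem_powerset] at h
    refine Finset.sum_eq_zero fun i _ => ?_
    rw [coeff_one, if_neg]
    · simp
    · rintro ⟨h', -⟩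
      exact hT (h.antisymm (Finset.sdiff_eq_empty_iff_subset.1 h'))
  · simp

protected theorem mul_assoc (f g h : SSeries) : f * g * h = f * (g * h) := by
  ext S w
  simp only [coeff_mul, Finset.mul_sum, Finset.sum_mul]
  simp only [Finset.sum_sigma']
  refine Finset.sum_nbij'
    (fun t => ⟨t.2.2.1, t.2.2.2, t.1 \ t.2.2.1, t.2.1 - t.2.2.2⟩)
    (fun t => ⟨t.1 ∪ t.2.2.1, t.2.1 + t.2.2.2, t.1, t.2.1⟩) ?_ ?_ ?_ ?_ ?_
  · rintro ⟨T, i, U, j⟩ ht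
    simp only [Finset.mem_sigma, Finset.mem_powerset, Finset.mem_range, List.length_take,
      List.length_drop] at ht ⊢
    obtain ⟨hT, hi, hU, hj⟩ := ht
    exact ⟨hU.trans hT, by omega, Finset.sdiff_subset_sdiff hT subset_rfl, by omega⟩
  · rintro ⟨U, j, V, k⟩ ht
    simp only [Finset.mem_sigma, Finset.mem_powerset, Finset.mem_range, List.length_take,
      List.length_drop] at ht ⊢
    obtain ⟨hU, hj, hV, hk⟩ := ht
    exact ⟨Finset.union_subset hU (hV.trans Finset.sdiff_subset), by omega,
      Finset.subset_union_left, by omega⟩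
  · rintro ⟨T, i, U, j⟩ ht
    simp only [Finset.mem_sigma, Finset.mem_powerset, Finset.mem_range, List.length_take] at ht
    obtain ⟨hT, hi, hU, hj⟩ := ht
    have h1 : U ∪ T \ U = T := Finset.union_sdiff_of_subset hU
    have h2 : j + (i - j) = i := by omega
    simp only [h1, h2]
  · rintro ⟨U, j, V, k⟩ ht
    simp only [Finset.mem_sigma, Finset.mem_powerset, Finset.mem_range] at ht
    obtain ⟨hU, hj, hV, hk⟩ := ht
    have h1 : (U ∪ V) \ U = V := by
      rw [Finset.union_sdiff_left]
      exact Finset.sdiff_eq_self_of_disjoint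
        (Finset.disjoint_of_subset_left hV Finset.sdiff_disjoint)
    have h2 : j + k - j = k := by omega
    simp only [h1, h2]
  · rintro ⟨T, i, U, j⟩ ht
    simp only [Finset.mem_sigma, Finset.mem_powerset, Finset.mem_range, List.length_take] at ht
    obtain ⟨hT, hi, hU, hj⟩ := ht
    have hji : j ≤ i := by omega
    have e1 : S \ U = T \ U ∪ S \ T := by
      ext x
      simp only [Finset.mem_sdiff, Finset.mem_union]
      have := @hT x
      have := @hU x
      tauto
    have e2 : (S \ U) \ (T \ U) = S \ T := by
      ext x
      simp only [Finset.mem_sdiff]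
      have := @hT x
      have := @hU x
      tauto
    have d1 : Disjoint (T \ U) (S \ T) :=
      Finset.disjoint_of_subset_left Finset.sdiff_subset Finset.disjoint_sdiff
    have e3 : sgn T (S \ T) = sgn U (S \ T) * sgn (T \ U) (S \ T) := by
      rw [← sgn_union_left Finset.disjoint_sdiff, Finset.union_sdiff_of_subset hU]
    have e4 : sgn U (S \ U) = sgn U (T \ U) * sgn U (S \ T) := by
      rw [e1, sgn_union_right d1]
    have e5 : (w.take i).take j = w.take j := by
      rw [List.take_take, min_eq_left hji]
    have e6 : (w.take i).drop j = (w.drop j).take (i - j) := List.drop_take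
    have e7 : (w.drop j).drop (i - j) = w.drop i := by
      rw [List.drop_drop, Nat.add_sub_cancel' hji]
    simp only [e2, e3, e4, e5, e6, e7]
    ring

instance : Ring SSeries :=
  { (inferInstance : AddCommGroup SSeries) with
    mul_assoc := SSeries.mul_assoc
    one_mul := SSeries.one_mul
    mul_one := SSeries.mul_one
    left_distrib := fun f g h => by
      ext S w
      simp only [coeff_add, coeff_mul, mul_add, Finset.sum_add_distrib]
    right_distrib := fun f g h => by
      ext S w
      simp only [coeff_add, coeff_mul, mul_add, add_mul, Finset.sum_add_distrib]
    zero_mul := fun f => by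
      ext S w
      simp [coeff_mul]
    mul_zero := fun f => by
      ext S w
      simp [coeff_mul] }

instance : Algebra ℚ SSeries :=
  Algebra.ofModule
    (fun r f g => by
      ext S w
      simp only [coeff_smul, coeff_mul, Finset.mul_sum]
      refine Finset.sum_congr rfl fun _ _ => Finset.sum_congr rfl fun _ _ => by ring)
    (fun r f g => by
      ext S w
      simp only [coeff_smul, coeff_mul, Finset.mul_sum]
      refine Finset.sum_congr rfl fun _ _ => Finset.sum_congr rfl fun _ _ => by ring)

/-- The variable `x i`. -/
def x (i : ℕ+) : SSeries := single ∅ [i]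

/-- The variable `θ i`. -/
def θ (i : ℕ+) : SSeries := single {i} []

theorem single_mul_single (A B : Finset ℕ+) (u v : List ℕ+) :
    single A u * single B v = if Disjoint A B then sgn A B • single (A ∪ B) (u ++ v) else 0 := by
  ext S w
  rw [coeff_mul, Finset.sum_congr rfl (g := fun T => if T = A ∧ S \ T = B ∧ w = u ++ v then sgn A B else 0)]
  · split_ifs with h
    · rw [coeff_smul, coeff_single]
      by_cases hS : S = A ∪ B
      · subst hS
        rw [Finset.sum_eq_single A]
        · have : (A ∪ B) \ A = B := by
            rw [Finset.union_sdiff_left]; exact Finset.sdiff_eq_self_of_disjoint h.symm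
          simp [this]
        · intro T _ hT
          simp [hT]
        · exact fun hA => absurd (Finset.mem_powerset.2 Finset.subset_union_left) hA
      · rw [Finset.sum_eq_zero]
        · simp [hS]
        · intro T hT
          rw [if_neg]
          rintro ⟨rfl, rfl, -⟩
          exact hS (Finset.union_sdiff_of_subset (Finset.mem_powerset.1 hT)).symm
    · rw [Finset.sum_eq_zero]
      · rfl
      · intro T hT
        rw [if_neg]
        rintro ⟨rfl, rfl, -⟩
        exact h Finset.disjoint_sdiff
  · intro T _
    simp only [coeff_single]
    by_cases h : T = A ∧ S \ T = B ∧ w = u ++ v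
    · rw [if_pos h]
      obtain ⟨rfl, rfl, rfl⟩ := h
      rw [Finset.sum_eq_single u.length]
      · simp
      · intro i hi hne
        have : (u ++ v).take i ≠ u := fun h => hne (by
          have := congrArg List.length h
          simp only [Finset.mem_range] at hi
          rw [List.length_take] at this
          omega)
        simp [this]
      · simp
    · rw [if_neg h]
      refine Finset.sum_eq_zero fun i _ => ?_
      by_contra hne
      apply h
      have h1 : T = A ∧ w.take i = u := by by_contra hc; simp [hc] at hne
      have h2 : S \ T = B ∧ w.drop i = v := by by_contra hc; simp [hc] at hne
      exact ⟨h1.1, h2.1, by rw [← h1.2, ← h2.2, List.take_append_drop]⟩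

theorem x_mul_θ (i j : ℕ+) : x i * θ j = θ j * x i := by
  simp [x, θ, single_mul_single]

theorem θ_mul_θ (i j : ℕ+) : θ i * θ j = -(θ j * θ i) := by
  have key : ∀ i j : ℕ+, i < j → θ i * θ j = -(θ j * θ i) := by
    intro i j h
    have h1 : sgn {i} {j} = 1 := by
      simp [sgn, Finset.filter_singleton, h.le.not_gt]
    have h2 : sgn {j} {i} = -1 := by
      simp [sgn, Finset.filter_singleton, h]
    simp only [θ, single_mul_single, Finset.disjoint_singleton]
    rw [if_pos h.ne, if_pos h.ne', h1, h2, Finset.union_comm]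
    simp
  rcases lt_trichotomy i j with h | rfl | h
  · exact key i j h
  · simp [θ, single_mul_single]
  · rw [key j i h, neg_neg]

/-- The monomial `θ_{a_1} ⋯ θ_{a_m} x_{b_1} ⋯ x_{b_n}`. -/
def word {m n : ℕ} (a : Fin m → ℕ+) (b : Fin n → ℕ+) : SSeries :=
  (List.ofFn fun i => θ (a i)).prod * (List.ofFn fun j => x (b j)).prod

theorem prod_x (l : List ℕ+) : (l.map x).prod = single ∅ l := by
  induction l with
  | nil => rfl
  | cons i l ih => simp [ih, x, single_mul_single]

theorem prod_θ (l : List ℕ+) : ∃ r : ℚ, (l.map θ).prod = r • single l.toFinset [] := by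
  induction l with
  | nil => exact ⟨1, by rw [one_smul]; rfl⟩
  | cons i l ih =>
    obtain ⟨r, hr⟩ := ih
    rw [List.map_cons, List.prod_cons, hr, mul_smul_comm, θ, single_mul_single]
    split_ifs
    · exact ⟨r * sgn {i} l.toFinset, by rw [smul_smul, List.toFinset_cons]; rfl⟩
    · exact ⟨0, by simp⟩

theorem coeff_word_ne_zero {m n : ℕ} {a : Fin m → ℕ+} {b : Fin n → ℕ+} {S w}
    (h : (word a b).coeff S w ≠ 0) : S = Finset.univ.image a ∧ w = List.ofFn b := by
  obtain ⟨r, hr⟩ := prod_θ (List.ofFn a)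
  have hx := prod_x (List.ofFn b)
  rw [List.map_ofFn] at hr hx
  have : word a b = r • single (List.ofFn a).toFinset (List.ofFn b) := by
    change (List.ofFn (θ ∘ a)).prod * (List.ofFn (x ∘ b)).prod = _
    rw [hr, hx, smul_mul_assoc, single_mul_single]
    simp
  rw [this, coeff_smul, coeff_single] at h
  have h' := right_ne_zero_of_mul h
  have h'' : S = (List.ofFn a).toFinset ∧ w = List.ofFn b := by
    by_contra hc; exact h' (if_neg hc)
  refine ⟨?_, h''.2⟩
  rw [h''.1]
  ext i
  simp [List.mem_ofFn]

theorem finite_support_word {m n : ℕ} (c : (Fin m → ℕ+) → (Fin n → ℕ+) → ℚ) (S w) :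
    (Function.support fun t : (Fin m → ℕ+) × (Fin n → ℕ+) =>
      c t.1 t.2 * (word t.1 t.2).coeff S w).Finite := by
  have h1 : {a : Fin m → ℕ+ | ∀ i, a i ∈ S}.Finite := by
    have := Set.Finite.pi' (fun _ : Fin m => S.finite_toSet)
    simpa using this
  have h2 : {b : Fin n → ℕ+ | w = List.ofFn b}.Finite :=
    Set.Subsingleton.finite fun b hb b' hb' => List.ofFn_injective (hb.symm.trans hb')
  refine (h1.prod h2).subset ?_
  rintro ⟨a, b⟩ h
  obtain ⟨rfl, hw⟩ := coeff_word_ne_zero (right_ne_zero_of_mul h)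
  exact ⟨fun i => Finset.mem_image_of_mem _ (Finset.mem_univ i), hw⟩

/-- The formal sum of the monomials `c(a, b) θ_{a_1} ⋯ θ_{a_m} x_{b_1} ⋯ x_{b_n}` over all indices
`a`, `b`. Each coefficient is a finite sum by `finite_support_word`. -/
noncomputable def wordSum {m n : ℕ} (c : (Fin m → ℕ+) → (Fin n → ℕ+) → ℚ) : SSeries :=
  ⟨fun S w => ∑ᶠ t : (Fin m → ℕ+) × (Fin n → ℕ+), c t.1 t.2 * (word t.1 t.2).coeff S w,
    m + n, fun S w h => by
      obtain ⟨t, ht⟩ : ∃ t : (Fin m → ℕ+) × (Fin n → ℕ+),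
          c t.1 t.2 * (word t.1 t.2).coeff S w ≠ 0 := by
        by_contra hc
        push Not at hc
        exact h (finsum_eq_zero_of_forall_eq_zero hc)
      obtain ⟨rfl, rfl⟩ := coeff_word_ne_zero (right_ne_zero_of_mul ht)
      have := Finset.card_image_le (s := Finset.univ) (f := t.1)
      simp only [Finset.card_univ, Fintype.card_fin] at this
      simpa using this⟩

end SSeries

/-- The minimum of a finite set of naturals, with `min ∅ = 0`. -/
noncomputable def minElt (A : Finset ℕ) : ℕ := sInf (A : Set ℕ)

/-- The `r`-shift `A[r]`: add `r` to every nonzero element of `A`. -/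
def shift (r : ℕ) (A : Finset ℕ) : Finset ℕ := A.image fun j => if j = 0 then 0 else j + r

theorem minElt_mem {A : Finset ℕ} (h : A.Nonempty) : minElt A ∈ A := by
  have := Nat.sInf_mem (s := (A : Set ℕ)) h
  exact_mod_cast this

theorem minElt_le {A : Finset ℕ} {j : ℕ} (h : j ∈ A) : minElt A ≤ j :=
  Nat.sInf_le (by exact_mod_cast h)

theorem zero_mem_shift {r : ℕ} {A : Finset ℕ} : 0 ∈ shift r A ↔ 0 ∈ A := by
  simp only [shift, Finset.mem_image]
  constructor
  · rintro ⟨j, hj, h⟩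
    split_ifs at h with h0
    · exact h0 ▸ hj
    · omega
  · exact fun h => ⟨0, h, by simp⟩

theorem mem_shift {r : ℕ} {A : Finset ℕ} {j : ℕ} (hj : j ≠ 0) :
    j ∈ shift r A ↔ r < j ∧ j - r ∈ A := by
  simp only [shift, Finset.mem_image]
  constructor
  · rintro ⟨k, hk, h⟩
    split_ifs at h with h0
    · omega
    · subst h
      exact ⟨by omega, by simpa using hk⟩
  · rintro ⟨h1, h2⟩
    exact ⟨j - r, h2, by rw [if_neg (by omega)]; omega⟩

/-- A partial set supercomposition `(K_1, …, K_q)` of degree `n` and fermionic degree `m`.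
The tuple is stored as its first `m` blocks `ferm`, which contain `0`, followed by the list `bos` of
the remaining blocks, which do not contain `0` and are sorted by their minima.
The blocks cover `{1, …, n}` and two of them meet at most in `0`. The block `{0}` may be repeated. -/
@[ext] structure SetSupercomp (n m : ℕ) where
  ferm : Fin m → Finset ℕ
  bos : List (Finset ℕ)
  zero_mem_ferm : ∀ i, 0 ∈ ferm i
  zero_notMem_bos : ∀ B ∈ bos, 0 ∉ B
  bos_nonempty : ∀ B ∈ bos, B.Nonempty
  cover : ∀ j, j ≠ 0 → ((∃ i, j ∈ ferm i) ∨ (∃ B ∈ bos, j ∈ B) ↔ j ≤ n)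
  inter : (List.ofFn ferm ++ bos).Pairwise fun A B => A ∩ B ⊆ {0}
  sorted : bos.Pairwise fun A B => minElt A < minElt B

namespace SetSupercomp

variable {n m p q : ℕ}

/-- The tuple `(K_1, …, K_q)` of all blocks. -/
def blocks (K : SetSupercomp n m) : List (Finset ℕ) := List.ofFn K.ferm ++ K.bos

theorem mem_blocks {K : SetSupercomp n m} {B : Finset ℕ} :
    B ∈ K.blocks ↔ (∃ i, K.ferm i = B) ∨ B ∈ K.bos := by
  simp [blocks, List.mem_ofFn]

/-- `i` and `j` belong to the same block of `K`. -/
def SameBlock (K : SetSupercomp n m) (i j : ℕ) : Prop := ∃ B ∈ K.blocks, i ∈ B ∧ j ∈ B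

/-- `K` is a set superpartition: `K_i ≠ K_j` and `min (K_i \ K_j) < min (K_j \ K_i)` for `i < j`,
where `min ∅ = 0`. -/
def IsSuperpartition (K : SetSupercomp n m) : Prop :=
  K.blocks.Pairwise fun A B => A ≠ B ∧ minElt (A \ B) < minElt (B \ A)

theorem le_of_mem {K : SetSupercomp n m} {B : Finset ℕ} (hB : B ∈ K.blocks) {j : ℕ}
    (hj : j ∈ B) : j ≤ n := by
  by_cases h0 : j = 0
  · omega
  · refine (K.cover j h0).1 ?_
    rcases mem_blocks.1 hB with ⟨i, rfl⟩ | hB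
    · exact Or.inl ⟨i, hj⟩
    · exact Or.inr ⟨B, hB, hj⟩

theorem exists_mem (K : SetSupercomp n m) {j : ℕ} (h0 : j ≠ 0) (hj : j ≤ n) :
    ∃ B ∈ K.blocks, j ∈ B := by
  rcases (K.cover j h0).2 hj with ⟨i, hi⟩ | ⟨B, hB, h⟩
  · exact ⟨_, mem_blocks.2 (Or.inl ⟨i, rfl⟩), hi⟩
  · exact ⟨B, mem_blocks.2 (Or.inr hB), h⟩

theorem ferm_inj {K : SetSupercomp n m} {i k : Fin m} {j : ℕ} (h0 : j ≠ 0)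
    (hi : j ∈ K.ferm i) (hk : j ∈ K.ferm k) : i = k := by
  have h := List.pairwise_ofFn.1 (List.pairwise_append.1 K.inter).1
  by_contra hne
  rcases lt_or_gt_of_ne hne with hl | hl
  · exact h0 (Finset.mem_singleton.1 (h hl (Finset.mem_inter.2 ⟨hi, hk⟩)))
  · exact h0 (Finset.mem_singleton.1 (h hl (Finset.mem_inter.2 ⟨hk, hi⟩)))

theorem notMem_ferm {K : SetSupercomp n m} {B : Finset ℕ} (hB : B ∈ K.bos) {j : ℕ}
    (hj : j ∈ B) (i : Fin m) : j ∉ K.ferm i := by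
  intro hi
  have h := (List.pairwise_append.1 K.inter).2.2 (K.ferm i) (by simp [List.mem_ofFn]) B hB
  have h0 : j = 0 := Finset.mem_singleton.1 (h (Finset.mem_inter.2 ⟨hi, hj⟩))
  exact K.zero_notMem_bos B hB (h0 ▸ hj)

theorem block_unique {K : SetSupercomp n m} {A B : Finset ℕ} (hA : A ∈ K.blocks)
    (hB : B ∈ K.blocks) {j : ℕ} (h0 : j ≠ 0) (hjA : j ∈ A) (hjB : j ∈ B) : A = B := by
  rcases mem_blocks.1 hA with ⟨i, rfl⟩ | hA <;> rcases mem_blocks.1 hB with ⟨k, rfl⟩ | hB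
  · rw [ferm_inj h0 hjA hjB]
  · exact absurd hjA (notMem_ferm hB hjB i)
  · exact absurd hjB (notMem_ferm hA hjA k)
  · by_contra hne
    have : Std.Symm fun A B : Finset ℕ => A ∩ B ⊆ {0} :=
      ⟨fun A B hAB => by rwa [Finset.inter_comm]⟩
    have h := (List.pairwise_append.1 K.inter).2.1.forall hA hB hne
    exact h0 (Finset.mem_singleton.1 (h (Finset.mem_inter.2 ⟨hjA, hjB⟩)))

theorem ne_zero_of_mem_bos {K : SetSupercomp n m} {B : Finset ℕ} (hB : B ∈ K.bos) {j : ℕ}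
    (hj : j ∈ B) : j ≠ 0 := fun h => K.zero_notMem_bos B hB (h ▸ hj)

theorem sameBlock_of_ferm {K : SetSupercomp n m} {i : Fin m} {j k : ℕ} (hj : j ∈ K.ferm i)
    (hk : k ∈ K.ferm i) : K.SameBlock j k := ⟨_, mem_blocks.2 (Or.inl ⟨i, rfl⟩), hj, hk⟩

theorem sameBlock_of_bos {K : SetSupercomp n m} {B : Finset ℕ} (hB : B ∈ K.bos) {j k : ℕ}
    (hj : j ∈ B) (hk : k ∈ B) : K.SameBlock j k := ⟨_, mem_blocks.2 (Or.inr hB), hj, hk⟩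

theorem SameBlock.mem {K : SetSupercomp n m} {j k : ℕ} (h : K.SameBlock j k) (h0 : j ≠ 0)
    {B : Finset ℕ} (hB : B ∈ K.blocks) (hj : j ∈ B) : k ∈ B := by
  obtain ⟨A, hA, hjA, hkA⟩ := h
  rwa [← block_unique hA hB h0 hjA hj]

theorem SameBlock.mem_ferm {K : SetSupercomp n m} {j k : ℕ} (h : K.SameBlock j k) (h0 : j ≠ 0)
    {i : Fin m} (hj : j ∈ K.ferm i) : k ∈ K.ferm i :=
  h.mem h0 (mem_blocks.2 (Or.inl ⟨i, rfl⟩)) hj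

theorem SameBlock.symm {K : SetSupercomp n m} {j k : ℕ} (h : K.SameBlock j k) :
    K.SameBlock k j := by
  obtain ⟨A, hA, hjA, hkA⟩ := h
  exact ⟨A, hA, hkA, hjA⟩

theorem ext_of_sameBlock {K L : SetSupercomp n m} (hF : K.ferm = L.ferm)
    (h : ∀ i j, i ≠ 0 → j ≠ 0 → i ≤ n → j ≤ n → (K.SameBlock i j ↔ L.SameBlock i j)) :
    K = L := by
  have key : ∀ K L : SetSupercomp n m, K.ferm = L.ferm →
      (∀ i j, i ≠ 0 → j ≠ 0 → i ≤ n → j ≤ n → (K.SameBlock i j ↔ L.SameBlock i j)) →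
      ∀ B ∈ K.bos, B ∈ L.bos := by
    intro K L hF h B hB
    obtain ⟨j, hj⟩ := K.bos_nonempty B hB
    have hj0 := ne_zero_of_mem_bos hB hj
    have hjn := le_of_mem (mem_blocks.2 (Or.inr hB)) hj
    rcases (L.cover j hj0).2 hjn with ⟨i, hi⟩ | ⟨C, hC, hjC⟩
    · exact absurd (hF ▸ hi) (notMem_ferm hB hj i)
    · have : B = C := by
        ext k
        constructor
        · intro hk
          exact ((h j k hj0 (ne_zero_of_mem_bos hB hk) hjn
            (le_of_mem (mem_blocks.2 (Or.inr hB)) hk)).1 (sameBlock_of_bos hB hj hk)).mem hj0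
            (mem_blocks.2 (Or.inr hC)) hjC
        · intro hk
          exact ((h j k hj0 (ne_zero_of_mem_bos hC hk) hjn
            (le_of_mem (mem_blocks.2 (Or.inr hC)) hk)).2 (sameBlock_of_bos hC hjC hk)).mem hj0
            (mem_blocks.2 (Or.inr hB)) hj
      exact this ▸ hC
  refine SetSupercomp.ext hF ?_
  have nd : ∀ K : SetSupercomp n m, K.bos.Nodup := fun K =>
    K.sorted.imp fun h e => by simp [e] at h
  refine List.Perm.eq_of_pairwise (le := fun A B => minElt A < minElt B) ?_ K.sorted L.sorted
    ((List.perm_ext_iff_of_nodup (nd K) (nd L)).2 fun B => ⟨key K L hF h B,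
      key L K hF.symm (fun i j a b c d => (h i j a b c d).symm) B⟩)
  intro A B _ _ h1 h2
  exact absurd h1 h2.asymm

/-- Strong coarsening `K ⊑ L`: the `i`th fermionic block of `L` is the `i`th fermionic block of `K`
joined with some nonfermionic blocks of `K`, and each nonfermionic block of `L` is a union of
nonfermionic blocks of `K`. -/
instance : LE (SetSupercomp n m) where
  le K L :=
    (∀ i, ∃ S : Finset (Finset ℕ), (∀ B ∈ S, B ∈ K.bos) ∧ L.ferm i = K.ferm i ∪ S.biUnion id) ∧
    ∀ C ∈ L.bos, ∃ S : Finset (Finset ℕ), (∀ B ∈ S, B ∈ K.bos) ∧ C = S.biUnion id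

theorem le_iff {K L : SetSupercomp n m} : K ≤ L ↔
    (∀ i, K.ferm i ⊆ L.ferm i) ∧
      ∀ i j, i ≠ 0 → j ≠ 0 → K.SameBlock i j → L.SameBlock i j := by
  constructor
  · rintro ⟨h1, h2⟩
    have hF : ∀ i, K.ferm i ⊆ L.ferm i := fun i => by
      obtain ⟨S, _, hS⟩ := h1 i
      rw [hS]
      exact Finset.subset_union_left
    refine ⟨hF, ?_⟩
    rintro i j hi hj ⟨B, hB, hiB, hjB⟩
    rcases mem_blocks.1 hB with ⟨k, rfl⟩ | hB'
    · exact sameBlock_of_ferm (hF k hiB) (hF k hjB)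
    · have hsub : ∀ S : Finset (Finset ℕ), (∀ B ∈ S, B ∈ K.bos) → i ∈ S.biUnion id →
          j ∈ S.biUnion id := by
        intro S hS hiS
        obtain ⟨C, hC, hiC⟩ := Finset.mem_biUnion.1 hiS
        have : B = C := block_unique hB (mem_blocks.2 (Or.inr (hS C hC))) hi hiB hiC
        exact Finset.mem_biUnion.2 ⟨C, hC, this ▸ hjB⟩
      obtain ⟨C, hC, hiC⟩ := L.exists_mem hi (le_of_mem hB hiB)
      refine ⟨C, hC, hiC, ?_⟩
      rcases mem_blocks.1 hC with ⟨k, rfl⟩ | hC'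
      · obtain ⟨S, hS, e⟩ := h1 k
        rw [e] at hiC ⊢
        rcases Finset.mem_union.1 hiC with h | h
        · exact absurd h (notMem_ferm hB' hiB k)
        · exact Finset.mem_union_right _ (hsub S hS h)
      · obtain ⟨S, hS, e⟩ := h2 C hC'
        rw [e] at hiC ⊢
        exact hsub S hS hiC
  · rintro ⟨hF, h⟩
    have main : ∀ C ∈ L.blocks, ∀ j ∈ C, ∀ B ∈ K.bos, j ∈ B → B ⊆ C := by
      intro C hC j hj B hB hjB k hk
      have hj0 := ne_zero_of_mem_bos hB hjB
      exact (h j k hj0 (ne_zero_of_mem_bos hB hk) (sameBlock_of_bos hB hjB hk)).mem hj0 hC hj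
    refine ⟨fun i => ⟨K.bos.toFinset.filter (· ⊆ L.ferm i), by simp +contextual, ?_⟩,
      fun C hC => ⟨K.bos.toFinset.filter (· ⊆ C), by simp +contextual, ?_⟩⟩
    · have hb : L.ferm i ∈ L.blocks := mem_blocks.2 (Or.inl ⟨i, rfl⟩)
      apply Finset.Subset.antisymm
      · intro j hj
        by_cases hj0 : j = 0
        · exact Finset.mem_union_left _ (hj0 ▸ K.zero_mem_ferm i)
        · rcases (K.cover j hj0).2 (le_of_mem hb hj) with ⟨k, hk⟩ | ⟨B, hB, hjB⟩
          · rw [ferm_inj hj0 hj (hF k hk)]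
            exact Finset.mem_union_left _ hk
          · exact Finset.mem_union_right _ (Finset.mem_biUnion.2
              ⟨B, Finset.mem_filter.2 ⟨List.mem_toFinset.2 hB, main _ hb j hj B hB hjB⟩, hjB⟩)
      · refine Finset.union_subset (hF i) (Finset.biUnion_subset.2 fun B hB => ?_)
        exact (Finset.mem_filter.1 hB).2
    · have hb : C ∈ L.blocks := mem_blocks.2 (Or.inr hC)
      apply Finset.Subset.antisymm
      · intro j hj
        have hj0 := ne_zero_of_mem_bos hC hj
        rcases (K.cover j hj0).2 (le_of_mem hb hj) with ⟨k, hk⟩ | ⟨B, hB, hjB⟩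
        · exact absurd (hF k hk) (notMem_ferm hC hj k)
        · exact Finset.mem_biUnion.2
            ⟨B, Finset.mem_filter.2 ⟨List.mem_toFinset.2 hB, main _ hb j hj B hB hjB⟩, hjB⟩
      · exact Finset.biUnion_subset.2 fun B hB => (Finset.mem_filter.1 hB).2

instance : PartialOrder (SetSupercomp n m) where
  le_refl K := le_iff.2 ⟨fun _ => subset_rfl, fun _ _ _ _ h => h⟩
  le_trans K L N h1 h2 := by
    rw [le_iff] at *
    exact ⟨fun i => (h1.1 i).trans (h2.1 i), fun i j hi hj h => h2.2 i j hi hj (h1.2 i j hi hj h)⟩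
  le_antisymm K L h1 h2 := by
    rw [le_iff] at *
    exact ext_of_sameBlock (funext fun i => (h1.1 i).antisymm (h2.1 i))
      fun i j hi hj _ _ => ⟨h1.2 i j hi hj, h2.2 i j hi hj⟩

section ofColor

variable {α : Type*} [DecidableEq α] (n) (F : Fin m → Finset ℕ) (col : ℕ → α)

/-- The elements of `[n]` outside the sets `F i`. -/
def rest : Finset ℕ := (Finset.Icc 1 n).filter fun j => ∀ i, j ∉ F i

/-- The elements in `rest` with the same colour as `j`. -/
def colorClass (j : ℕ) : Finset ℕ := (rest n F).filter fun k => col k = col j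

/-- The least elements of the colour classes. -/
def reps : Finset ℕ := (rest n F).filter fun j => ∀ k ∈ rest n F, col k = col j → j ≤ k

variable {n F col}

theorem mem_rest {j : ℕ} : j ∈ rest n F ↔ (1 ≤ j ∧ j ≤ n) ∧ ∀ i, j ∉ F i := by
  simp [rest]

theorem mem_colorClass {j k : ℕ} :
    k ∈ colorClass n F col j ↔ k ∈ rest n F ∧ col k = col j := by
  simp [colorClass]

theorem exists_rep {j : ℕ} (hj : j ∈ rest n F) :
    ∃ r ∈ reps n F col, col r = col j := by
  have hne : (colorClass n F col j).Nonempty := ⟨j, mem_colorClass.2 ⟨hj, rfl⟩⟩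
  have h := mem_colorClass.1 (minElt_mem hne)
  refine ⟨minElt (colorClass n F col j), ?_, h.2⟩
  refine Finset.mem_filter.2 ⟨h.1, fun k hk e => ?_⟩
  exact minElt_le (mem_colorClass.2 ⟨hk, e.trans h.2⟩)

theorem minElt_colorClass {r : ℕ} (hr : r ∈ reps n F col) :
    minElt (colorClass n F col r) = r := by
  have hr' := Finset.mem_filter.1 hr
  have hm : r ∈ colorClass n F col r := mem_colorClass.2 ⟨hr'.1, rfl⟩
  have h := mem_colorClass.1 (minElt_mem ⟨r, hm⟩)
  exact (minElt_le hm).antisymm (hr'.2 _ h.1 h.2)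

variable (n F col)

/-- The partial set supercomposition with fermionic blocks `F i` whose nonfermionic blocks are the
colour classes of the remaining elements of `[n]`. -/
def ofColor (h0 : ∀ i, 0 ∈ F i) (hn : ∀ i, ∀ j ∈ F i, j ≤ n)
    (hF : ∀ i k, i ≠ k → F i ∩ F k ⊆ {0}) : SetSupercomp n m where
  ferm := F
  bos := ((reps n F col).sort (· ≤ ·)).map (colorClass n F col)
  zero_mem_ferm := h0
  zero_notMem_bos := by
    intro B hB hm
    obtain ⟨r, hr, rfl⟩ := List.mem_map.1 hB
    have := mem_rest.1 (mem_colorClass.1 hm).1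
    omega
  bos_nonempty := by
    intro B hB
    obtain ⟨r, hr, rfl⟩ := List.mem_map.1 hB
    exact ⟨r, mem_colorClass.2 ⟨(Finset.mem_filter.1 ((Finset.mem_sort _).1 hr)).1, rfl⟩⟩
  cover := by
    intro j hj
    constructor
    · rintro (⟨i, hi⟩ | ⟨B, hB, hjB⟩)
      · exact hn i j hi
      · obtain ⟨r, hr, rfl⟩ := List.mem_map.1 hB
        exact (mem_rest.1 (mem_colorClass.1 hjB).1).1.2
    · intro hjn
      by_cases h : ∃ i, j ∈ F i
      · exact Or.inl h
      · right
        push Not at h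
        have hjr : j ∈ rest n F := mem_rest.2 ⟨⟨by omega, hjn⟩, h⟩
        obtain ⟨r, hr, e⟩ := exists_rep (col := col) hjr
        exact ⟨_, List.mem_map.2 ⟨r, (Finset.mem_sort _).2 hr, rfl⟩,
          mem_colorClass.2 ⟨hjr, e.symm⟩⟩
  inter := by
    refine List.pairwise_append.2 ⟨List.pairwise_ofFn.2 fun i k hik => hF i k hik.ne, ?_, ?_⟩
    · refine List.pairwise_map.2 ?_
      refine (Finset.sortedLT_sort (reps n F col)).pairwise.imp_of_mem ?_
      intro r s hr hs hrs j hj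
      exfalso
      obtain ⟨h1, h2⟩ := Finset.mem_inter.1 hj
      have e := (mem_colorClass.1 h1).2.symm.trans (mem_colorClass.1 h2).2
      have hr' := Finset.mem_filter.1 ((Finset.mem_sort _).1 hr)
      have hs' := Finset.mem_filter.1 ((Finset.mem_sort _).1 hs)
      exact absurd (hs'.2 r hr'.1 e) (not_le.2 hrs)
    · intro A hA B hB j hj
      exfalso
      obtain ⟨i, rfl⟩ := List.mem_ofFn.1 hA
      obtain ⟨r, hr, rfl⟩ := List.mem_map.1 hB
      obtain ⟨h1, h2⟩ := Finset.mem_inter.1 hj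
      exact (mem_rest.1 (mem_colorClass.1 h2).1).2 i h1
  sorted := by
    refine List.pairwise_map.2 ?_
    refine (Finset.sortedLT_sort (reps n F col)).pairwise.imp_of_mem ?_
    intro r s hr hs hrs
    rwa [minElt_colorClass ((Finset.mem_sort _).1 hr),
      minElt_colorClass ((Finset.mem_sort _).1 hs)]

theorem sameBlock_ofColor (h0 : ∀ i, 0 ∈ F i) (hn : ∀ i, ∀ j ∈ F i, j ≤ n)
    (hF : ∀ i k, i ≠ k → F i ∩ F k ⊆ {0}) (i j : ℕ) :
    (ofColor n F col h0 hn hF).SameBlock i j ↔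
      (∃ k, i ∈ F k ∧ j ∈ F k) ∨ (i ∈ rest n F ∧ j ∈ rest n F ∧ col i = col j) := by
  constructor
  · rintro ⟨B, hB, hi, hj⟩
    rcases mem_blocks.1 hB with ⟨k, rfl⟩ | hB
    · exact Or.inl ⟨k, hi, hj⟩
    · obtain ⟨r, hr, rfl⟩ := List.mem_map.1 hB
      have h1 := mem_colorClass.1 hi
      have h2 := mem_colorClass.1 hj
      exact Or.inr ⟨h1.1, h2.1, h1.2.trans h2.2.symm⟩
  · rintro (⟨k, hi, hj⟩ | ⟨hi, hj, e⟩)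
    · exact sameBlock_of_ferm (K := ofColor n F col h0 hn hF) hi hj
    · obtain ⟨r, hr, e'⟩ := exists_rep (col := col) hi
      exact ⟨_, mem_blocks.2 (Or.inr (List.mem_map.2 ⟨r, (Finset.mem_sort _).2 hr, rfl⟩)),
        mem_colorClass.2 ⟨hi, e'.symm⟩, mem_colorClass.2 ⟨hj, e.symm.trans e'.symm⟩⟩

end ofColor

/-- The block of `j` in `K`, for `j ∈ [n]`. -/
def blockOf (K : SetSupercomp n m) (j : ℕ) : Finset ℕ :=
  (K.blocks.toFinset.filter fun B => j ∈ B).biUnion id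

theorem blockOf_eq {K : SetSupercomp n m} {B : Finset ℕ} (hB : B ∈ K.blocks) {j : ℕ}
    (h0 : j ≠ 0) (hj : j ∈ B) : K.blockOf j = B := by
  have : K.blocks.toFinset.filter (fun B => j ∈ B) = {B} := by
    ext C
    simp only [Finset.mem_filter, List.mem_toFinset, Finset.mem_singleton]
    constructor
    · rintro ⟨hC, hjC⟩
      exact block_unique hC hB h0 hjC hj
    · rintro rfl
      exact ⟨hB, hj⟩
  simp [blockOf, this]

theorem sameBlock_iff_blockOf {K : SetSupercomp n m} {i j : ℕ} (hi : i ≠ 0) (hj : j ≠ 0)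
    (hin : i ≤ n) : K.SameBlock i j ↔ K.blockOf i = K.blockOf j := by
  obtain ⟨B, hB, hiB⟩ := K.exists_mem hi hin
  constructor
  · intro h
    rw [blockOf_eq hB hi hiB, blockOf_eq hB hj (h.mem hi hB hiB)]
  · intro h
    rw [blockOf_eq hB hi hiB] at h
    have : i ∈ K.blockOf j := h ▸ hiB
    simp only [blockOf, Finset.mem_biUnion, Finset.mem_filter, List.mem_toFinset, id] at this
    obtain ⟨C, ⟨hC, hjC⟩, hiC⟩ := this
    exact ⟨C, hC, hiC, hjC⟩

/-- The strong coarsening order is a meet-semilattice, with meet `K ⊓ L`. -/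
instance : SemilatticeInf (SetSupercomp n m) where
  inf K L := ofColor n (fun i => K.ferm i ∩ L.ferm i) (fun j => (K.blockOf j, L.blockOf j))
    (fun i => Finset.mem_inter.2 ⟨K.zero_mem_ferm i, L.zero_mem_ferm i⟩)
    (fun i j hj => le_of_mem (mem_blocks.2 (Or.inl ⟨i, rfl⟩)) (Finset.mem_inter.1 hj).1)
    (fun i k hik j hj => by
      simp only [Finset.mem_inter] at hj
      by_contra h0
      exact hik (ferm_inj (by simpa using h0) hj.1.1 hj.2.1))
  inf_le_left K L := by
    refine le_iff.2 ⟨fun i => Finset.inter_subset_left, fun i j hi hj h => ?_⟩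
    rcases (sameBlock_ofColor ..).1 h with ⟨k, h1, h2⟩ | ⟨h1, h2, e⟩
    · exact sameBlock_of_ferm (Finset.mem_inter.1 h1).1 (Finset.mem_inter.1 h2).1
    · exact (sameBlock_iff_blockOf hi hj (mem_rest.1 h1).1.2).2 (Prod.ext_iff.1 e).1
  inf_le_right K L := by
    refine le_iff.2 ⟨fun i => Finset.inter_subset_right, fun i j hi hj h => ?_⟩
    rcases (sameBlock_ofColor ..).1 h with ⟨k, h1, h2⟩ | ⟨h1, h2, e⟩
    · exact sameBlock_of_ferm (Finset.mem_inter.1 h1).2 (Finset.mem_inter.1 h2).2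
    · exact (sameBlock_iff_blockOf hi hj (mem_rest.1 h1).1.2).2 (Prod.ext_iff.1 e).2
  le_inf N K L h1 h2 := by
    rw [le_iff] at h1 h2
    refine le_iff.2 ⟨fun i => Finset.subset_inter (h1.1 i) (h2.1 i), fun i j hi hj h => ?_⟩
    have hin : i ≤ n := by obtain ⟨B, hB, h, _⟩ := h; exact le_of_mem hB h
    have hjn : j ≤ n := by obtain ⟨B, hB, _, h⟩ := h; exact le_of_mem hB h
    have hK := h1.2 i j hi hj h
    have hL := h2.2 i j hi hj h
    refine (sameBlock_ofColor ..).2 ?_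
    by_cases hc : ∃ k, i ∈ K.ferm k ∩ L.ferm k
    · obtain ⟨k, hk⟩ := hc
      have hk' := Finset.mem_inter.1 hk
      exact Or.inl ⟨k, hk, Finset.mem_inter.2 ⟨hK.mem_ferm hi hk'.1, hL.mem_ferm hi hk'.2⟩⟩
    · push Not at hc
      refine Or.inr ⟨mem_rest.2 ⟨⟨by omega, hin⟩, hc⟩, mem_rest.2 ⟨⟨by omega, hjn⟩, ?_⟩, ?_⟩
      · intro k hk
        have hk' := Finset.mem_inter.1 hk
        exact hc k (Finset.mem_inter.2
          ⟨hK.symm.mem_ferm hj hk'.1, hL.symm.mem_ferm hj hk'.2⟩)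
      · exact Prod.ext ((sameBlock_iff_blockOf hi hj hin).1 hK)
          ((sameBlock_iff_blockOf hi hj hin).1 hL)

/-- The over product `K / L = K ∪ L[n]`: the fermionic blocks of `K`, then the fermionic blocks
of `L[n]`, then the nonfermionic blocks of `K`, then the nonfermionic blocks of `L[n]`. -/
def overProduct (K : SetSupercomp n m) (L : SetSupercomp p q) : SetSupercomp (n + p) (m + q) where
  ferm := Fin.append K.ferm fun i => shift n (L.ferm i)
  bos := K.bos ++ L.bos.map (shift n)
  zero_mem_ferm i := by
    refine Fin.addCases (fun i => ?_) (fun i => ?_) i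
    · rw [Fin.append_left]; exact K.zero_mem_ferm i
    · rw [Fin.append_right]; exact zero_mem_shift.2 (L.zero_mem_ferm i)
  zero_notMem_bos B hB := by
    rcases List.mem_append.1 hB with hB | hB
    · exact K.zero_notMem_bos B hB
    · obtain ⟨C, hC, rfl⟩ := List.mem_map.1 hB
      exact fun h => L.zero_notMem_bos C hC (zero_mem_shift.1 h)
  bos_nonempty B hB := by
    rcases List.mem_append.1 hB with hB | hB
    · exact K.bos_nonempty B hB
    · obtain ⟨C, hC, rfl⟩ := List.mem_map.1 hB
      exact (L.bos_nonempty C hC).image _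
  cover j hj := by
    constructor
    · rintro (⟨i, hi⟩ | ⟨B, hB, hjB⟩)
      · revert hi
        refine Fin.addCases (fun i => ?_) (fun i => ?_) i
        · rw [Fin.append_left]
          intro hi
          have := le_of_mem (mem_blocks.2 (Or.inl ⟨i, rfl⟩)) hi
          omega
        · rw [Fin.append_right, mem_shift hj]
          rintro ⟨h1, h2⟩
          have := le_of_mem (mem_blocks.2 (Or.inl ⟨i, rfl⟩)) h2
          omega
      · rcases List.mem_append.1 hB with hB | hB
        · have := le_of_mem (mem_blocks.2 (Or.inr hB)) hjB
          omega
        · obtain ⟨C, hC, rfl⟩ := List.mem_map.1 hB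
          have := le_of_mem (mem_blocks.2 (Or.inr hC)) ((mem_shift hj).1 hjB).2
          omega
    · intro h
      by_cases hjn : j ≤ n
      · rcases (K.cover j hj).2 hjn with ⟨i, hi⟩ | ⟨B, hB, hjB⟩
        · exact Or.inl ⟨Fin.castAdd q i, by rwa [Fin.append_left]⟩
        · exact Or.inr ⟨B, List.mem_append_left _ hB, hjB⟩
      · rcases (L.cover (j - n) (by omega)).2 (by omega) with ⟨i, hi⟩ | ⟨B, hB, hjB⟩
        · exact Or.inl ⟨Fin.natAdd m i, by
            rw [Fin.append_right, mem_shift hj]; exact ⟨by omega, hi⟩⟩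
        · exact Or.inr ⟨shift n B, List.mem_append_right _ (List.mem_map_of_mem hB),
            (mem_shift hj).2 ⟨by omega, hjB⟩⟩
  inter := by
    have hcross : ∀ A ∈ K.blocks, ∀ B, A ∩ shift n B ⊆ {0} := by
      intro A hA B j hj
      obtain ⟨h1, h2⟩ := Finset.mem_inter.1 hj
      by_contra h0
      have h0' : j ≠ 0 := by simpa using h0
      have := le_of_mem hA h1
      have := ((mem_shift h0').1 h2).1
      omega
    have hshift : ∀ A B : Finset ℕ, A ∩ B ⊆ {0} → shift n A ∩ shift n B ⊆ {0} := by
      intro A B h j hj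
      obtain ⟨h1, h2⟩ := Finset.mem_inter.1 hj
      by_contra h0
      have h0' : j ≠ 0 := by simpa using h0
      have h3 := (mem_shift h0').1 h1
      have h4 := (mem_shift h0').1 h2
      have h5 := Finset.mem_singleton.1 (h (Finset.mem_inter.2 ⟨h3.2, h4.2⟩))
      omega
    obtain ⟨k1, k2, k3⟩ := List.pairwise_append.1 K.inter
    obtain ⟨l1, l2, l3⟩ := List.pairwise_append.1 L.inter
    have kf : ∀ A ∈ List.ofFn K.ferm, A ∈ K.blocks := fun A hA => List.mem_append_left _ hA
    have kb : ∀ A ∈ K.bos, A ∈ K.blocks := fun A hA => List.mem_append_right _ hA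
    have e : List.ofFn (fun i => shift n (L.ferm i)) = (List.ofFn L.ferm).map (shift n) :=
      (List.map_ofFn ..).symm
    rw [List.ofFn_fin_append, e]
    simp only [List.pairwise_append, List.mem_append, List.pairwise_map, List.mem_map]
    refine ⟨⟨k1, l1.imp (hshift _ _), ?_⟩, ⟨k2, l2.imp (hshift _ _), ?_⟩, ?_⟩
    · rintro A hA _ ⟨B, hB, rfl⟩
      exact hcross A (kf A hA) B
    · rintro A hA _ ⟨B, hB, rfl⟩
      exact hcross A (kb A hA) B
    · rintro _ (hA | ⟨A, hA, rfl⟩) _ (hB | ⟨B, hB, rfl⟩)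
      · exact k3 _ hA _ hB
      · exact hcross _ (kf _ hA) B
      · rw [Finset.inter_comm]
        exact hcross _ (kb _ hB) A
      · exact hshift _ _ (l3 A hA B hB)
  sorted := by
    have hmin : ∀ B ∈ L.bos, minElt (shift n B) = minElt B + n := by
      intro B hB
      have hne := L.bos_nonempty B hB
      have h1 := minElt_mem hne
      have h1' := ne_zero_of_mem_bos hB h1
      have h2 := minElt_mem (hne.image (fun j => if j = 0 then 0 else j + n))
      change minElt (shift n B) ∈ shift n B at h2
      have h20 : minElt (shift n B) ≠ 0 := fun h =>
        L.zero_notMem_bos B hB (zero_mem_shift.1 (h ▸ h2))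
      have h3 := (mem_shift h20).1 h2
      have h4 := minElt_le h3.2
      have h5 : minElt B + n ∈ shift n B :=
        (mem_shift (by omega)).2 ⟨by omega, by simpa using h1⟩
      have h6 := minElt_le h5
      omega
    refine List.pairwise_append.2 ⟨K.sorted, List.pairwise_map.2 ?_, ?_⟩
    · refine L.sorted.imp_of_mem ?_
      intro A B hA hB h
      rw [hmin A hA, hmin B hB]
      omega
    · intro A hA C hC
      obtain ⟨B, hB, rfl⟩ := List.mem_map.1 hC
      rw [hmin B hB]
      have h1 := le_of_mem (mem_blocks.2 (Or.inr hA)) (minElt_mem (K.bos_nonempty A hA))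
      have h2 := ne_zero_of_mem_bos hB (minElt_mem (L.bos_nonempty B hB))
      omega

/-- `K! = |K_1|! ⋯ |K_q|!`, the number of ways to sort the elements of all blocks of `K`
simultaneously. -/
def blockFactorial (K : SetSupercomp n m) : ℕ := (K.blocks.map fun B => B.card.factorial).prod

/-- The monomial `θ_{a_1} ⋯ θ_{a_m} x_{b_1} ⋯ x_{b_n}` belongs to `M(K)`. The index `j : Fin n`
stands for the element `j + 1` of `[n]`. -/
def MonomialCond (K : SetSupercomp n m) (a : Fin m → ℕ+) (b : Fin n → ℕ+) : Prop :=
  (∀ (i : Fin m) (j : Fin n), a i = b j ↔ (j : ℕ) + 1 ∈ K.ferm i) ∧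
    ∀ i j : Fin n, b i = b j ↔ K.SameBlock (i + 1) (j + 1)

/-- The value `b_j` for `j ∈ [n]`. -/
def colorOf (b : Fin n → ℕ+) (j : ℕ) : Option ℕ+ :=
  if h : j - 1 < n then some (b ⟨j - 1, h⟩) else none

theorem colorOf_succ (b : Fin n → ℕ+) (j : Fin n) : colorOf b (j + 1) = some (b j) := by
  simp [colorOf]

/-- The unique `L` such that `θ_{a_1} ⋯ θ_{a_m} x_{b_1} ⋯ x_{b_n}` belongs to `M(L)`, for distinct
`a_1, …, a_m`; see `monomialCond_monomialType` and `MonomialCond.eq`. -/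
def monomialType (a : Fin m → ℕ+) (b : Fin n → ℕ+) (ha : Function.Injective a) :
    SetSupercomp n m :=
  ofColor n (fun i => insert 0 ((Finset.Icc 1 n).filter fun j => colorOf b j = some (a i)))
    (colorOf b) (by simp)
    (fun i j hj => by
      simp only [Finset.mem_insert, Finset.mem_filter, Finset.mem_Icc] at hj
      omega)
    (fun i k hik j hj => by
      simp only [Finset.mem_inter, Finset.mem_insert, Finset.mem_filter] at hj
      by_contra h0
      have h0' : j ≠ 0 := by simpa using h0
      have h1 := (hj.1.resolve_left h0').2
      have h2 := (hj.2.resolve_left h0').2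
      exact hik (ha (Option.some_inj.1 (h1.symm.trans h2))))

theorem monomialCond_monomialType (a : Fin m → ℕ+) (b : Fin n → ℕ+)
    (ha : Function.Injective a) : (monomialType a b ha).MonomialCond a b := by
  have hm : ∀ (i : Fin m) (j : Fin n), (j : ℕ) + 1 ∈ insert 0
      ((Finset.Icc 1 n).filter fun j => colorOf b j = some (a i)) ↔ a i = b j := by
    intro i j
    have := j.2
    simp only [Finset.mem_insert, Finset.mem_filter, Finset.mem_Icc, colorOf_succ,
      Option.some_inj]
    constructor
    · rintro (h | h)
      · omega
      · exact h.2.symm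
    · exact fun h => Or.inr ⟨by omega, h.symm⟩
  refine ⟨fun i j => (hm i j).symm, fun i j => ?_⟩
  refine Iff.trans ?_ (sameBlock_ofColor ..).symm
  simp only [hm, mem_rest, colorOf_succ, Option.some_inj]
  have hi := i.2
  have hj := j.2
  constructor
  · intro h
    by_cases hc : ∃ k, a k = b i
    · obtain ⟨k, hk⟩ := hc
      exact Or.inl ⟨k, hk, hk.trans h⟩
    · push Not at hc
      exact Or.inr ⟨⟨by omega, hc⟩, ⟨by omega, fun k => h ▸ hc k⟩, h⟩
  · rintro (⟨k, h1, h2⟩ | ⟨-, -, h⟩)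
    · exact h1.symm.trans h2
    · exact h

theorem MonomialCond.eq {K L : SetSupercomp n m} {a : Fin m → ℕ+} {b : Fin n → ℕ+}
    (hK : K.MonomialCond a b) (hL : L.MonomialCond a b) : K = L := by
  refine ext_of_sameBlock ?_ ?_
  · funext i
    ext j
    by_cases h0 : j = 0
    · subst h0
      simp [K.zero_mem_ferm, L.zero_mem_ferm]
    · by_cases hj : j ≤ n
      · obtain ⟨k, rfl⟩ : ∃ k : Fin n, j = k + 1 :=
          ⟨⟨j - 1, by omega⟩, by simp only; omega⟩
        exact (hK.1 i k).symm.trans (hL.1 i k)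
      · constructor
        · exact fun h => absurd (le_of_mem (mem_blocks.2 (Or.inl ⟨i, rfl⟩)) h) hj
        · exact fun h => absurd (le_of_mem (mem_blocks.2 (Or.inl ⟨i, rfl⟩)) h) hj
  · intro i j hi hj hin hjn
    obtain ⟨k, rfl⟩ : ∃ k : Fin n, i = k + 1 := ⟨⟨i - 1, by omega⟩, by simp only; omega⟩
    obtain ⟨l, rfl⟩ : ∃ k : Fin n, j = k + 1 := ⟨⟨j - 1, by omega⟩, by simp only; omega⟩
    exact (hK.2 k l).symm.trans (hL.2 k l)

/-- The conditions defining the monomials of the power sum function: `a_i = b_j` if `j ∈ K_i^+`, and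
`b_i = b_j` if `i, j` belong to the same block of `K`. -/
def PowerCond (K : SetSupercomp n m) (a : Fin m → ℕ+) (b : Fin n → ℕ+) : Prop :=
  (∀ (i : Fin m) (j : Fin n), (j : ℕ) + 1 ∈ K.ferm i → a i = b j) ∧
    ∀ i j : Fin n, K.SameBlock (i + 1) (j + 1) → b i = b j

open Classical in
/-- The power sum function `p_K`. -/
noncomputable def powerSum (K : SetSupercomp n m) : SSeries :=
  SSeries.wordSum fun a b => if K.PowerCond a b then 1 else 0

/-- The conditions defining the monomials of the elementary function: `a_i ≠ b_j` if `j ∈ K_i^+`, and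
`b_i ≠ b_j` if `i ≠ j` belong to the same block of `K`. -/
def ElemCond (K : SetSupercomp n m) (a : Fin m → ℕ+) (b : Fin n → ℕ+) : Prop :=
  (∀ (i : Fin m) (j : Fin n), (j : ℕ) + 1 ∈ K.ferm i → a i ≠ b j) ∧
    ∀ i j : Fin n, i ≠ j → K.SameBlock (i + 1) (j + 1) → b i ≠ b j

open Classical in
/-- The elementary function `e_K`. -/
noncomputable def elementary (K : SetSupercomp n m) : SSeries :=
  SSeries.wordSum fun a b => if K.ElemCond a b then 1 else 0

/-- A monomial is null-symmetric if `{a_1, …, a_m} \ {b_1, …, b_n}` has more than one element. -/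
def NullSymmetric (a : Fin m → ℕ+) (b : Fin n → ℕ+) : Prop :=
  1 < (Finset.univ.image a \ Finset.univ.image b).card

open Classical in
/-- The complete homogeneous function `h_K`: the sum of `(K ⊓ L)! u` over the nonzero
(that is, `a_1, …, a_m` distinct) monomials `u = θ_{a_1} ⋯ θ_{a_m} x_{b_1} ⋯ x_{b_n}` that are not
null-symmetric, where `L` is the unique partial set supercomposition with `u ∈ M(L)`. -/
noncomputable def complete (K : SetSupercomp n m) : SSeries :=
  SSeries.wordSum fun a b =>
    if h : Function.Injective a ∧ ¬ NullSymmetric a b then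
      ((K ⊓ monomialType a b h.1).blockFactorial : ℚ)
    else 0

end SetSupercomp

end Superspace

/-! Every function here is a formal sum of words `θ_a x_b` with coefficients depending on `(a, b)`.
Since each `x` commutes with each `θ`, the product of two words is, with no sign, the word obtained
by concatenating the `a`'s and the `b`'s (`word_mul_word`). Hence a product of two formal sums is
the formal sum whose coefficient at `(a, b)` is the product of the coefficients at its two halves
(`wordSum_mul_wordSum`), and it remains to see that the coefficients are multiplicative for the over
product. For `p` and `e` this is immediate: no block of the over product contains nonzero elements
of both halves, so the defining conditions split into one for each half (`powerCond_overProduct`,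
`elemCond_overProduct`). For `h` the coefficients as defined are not multiplicative, because being
null-symmetric is not a condition on the two halves separately. But the null-symmetric words may be
added to the sum with the same coefficient `(K ⊓ L)!`, since they cancel: exchanging two letters of
`a` absent from `b` changes the sign of the word and not its type `L` (`wordSum_nullSymmetric`,
`complete_eq_wordSum`). The new coefficient `meetCoeff` is multiplicative, because the meet of an
over product with the type of a word is the over product of the meets with the types of its halves
(`overProduct_inf`), and block factorials multiply. -/

namespace Superspace

/-! ### Signs: products of the `θ`'s as an alternating map -/

namespace SSeries

/-- Coefficient extraction as a linear map. -/
def coeffHom (S : Finset ℕ+) (w : List ℕ+) : SSeries →ₗ[ℚ] ℚ where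
  toFun f := f.coeff S w
  map_add' _ _ := rfl
  map_smul' _ _ := rfl

/-- The linear map sending the `i`th basis vector to `θ i`. -/
noncomputable def thetaMap : (ℕ+ →₀ ℚ) →ₗ[ℚ] SSeries := Finsupp.linearCombination ℚ θ

theorem thetaMap_single (i : ℕ+) : thetaMap (Finsupp.single i 1) = θ i := by
  simp [thetaMap]

theorem thetaMap_mul_thetaMap (v w : ℕ+ →₀ ℚ) :
    thetaMap v * thetaMap w = -(thetaMap w * thetaMap v) := by
  induction v using Finsupp.induction_linear with
  | zero => simp
  | add v v' hv hv' => rw [map_add, add_mul, mul_add, hv, hv', neg_add]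
  | single i r =>
    induction w using Finsupp.induction_linear with
    | zero => simp
    | add w w' hw hw' => rw [map_add, add_mul, mul_add, hw, hw', neg_add]
    | single j s =>
      simp only [thetaMap, Finsupp.linearCombination_single, smul_mul_smul_comm]
      rw [θ_mul_θ i j, smul_neg, mul_comm]

/-- Anticommutation of `v` with itself makes every coefficient its own negative. This is the
relation required to lift `thetaMap` to the exterior algebra, which then supplies all sign rules. -/
theorem thetaMap_mul_self (v : ℕ+ →₀ ℚ) : thetaMap v * thetaMap v = 0 := by
  ext S w
  exact self_eq_neg.1 (congrArg (coeffHom S w) (thetaMap_mul_thetaMap v v))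

/-- The products of elements in the span of the `θ i` as an alternating map. -/
noncomputable def thetaProd (m : ℕ) : (ℕ+ →₀ ℚ) [⋀^Fin m]→ₗ[ℚ] SSeries :=
  (ExteriorAlgebra.lift ℚ ⟨thetaMap, thetaMap_mul_self⟩).toLinearMap.compAlternatingMap
    (ExteriorAlgebra.ιMulti ℚ m)

theorem thetaProd_single {m : ℕ} (a : Fin m → ℕ+) :
    thetaProd m (fun i => Finsupp.single (a i) 1) = (List.ofFn fun i => θ (a i)).prod := by
  simp only [thetaProd, LinearMap.compAlternatingMap_apply, ExteriorAlgebra.ιMulti_apply,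
    AlgHom.toLinearMap_apply, map_list_prod, List.map_ofFn]
  congr 2
  funext i
  simp [thetaMap_single]

/-- An alternating map vanishes when two arguments agree. As a consequence, coefficients matter only
at injective `a`. -/
theorem word_eq_zero {m n : ℕ} {a : Fin m → ℕ+} (ha : ¬ Function.Injective a)
    (b : Fin n → ℕ+) : word a b = 0 := by
  simp only [Function.Injective, not_forall] at ha
  obtain ⟨i, j, h, hij⟩ := ha
  rw [word, ← thetaProd_single, (thetaProd m).map_eq_zero_of_eq _ (by rw [h]) hij, zero_mul]

theorem word_comp_swap {m n : ℕ} (a : Fin m → ℕ+) (b : Fin n → ℕ+) {i j : Fin m} (h : i ≠ j) :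
    word (a ∘ Equiv.swap i j) b = -word a b := by
  have := (thetaProd m).map_swap (fun i => Finsupp.single (a i) (1 : ℚ)) h
  rw [word, word, ← thetaProd_single, ← thetaProd_single, ← neg_mul, ← this]
  rfl

/-- For injective `a`, exchanging two letters is the same as exchanging the positions where they
occur, so the sign rule for positions applies. -/
theorem word_swap_comp {m n : ℕ} {a : Fin m → ℕ+} (ha : Function.Injective a) (b : Fin n → ℕ+)
    {i j : Fin m} (h : i ≠ j) : word (Equiv.swap (a i) (a j) ∘ a) b = -word a b := by
  rw [← word_comp_swap a b h]
  congr 1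
  exact (ha.swap_comp i j).symm ▸ rfl

/-! ### Concatenation of words and products of formal sums -/

theorem prod_x_mul_θ (l : List ℕ+) (s : List ℕ+) :
    Commute (l.map x).prod (s.map θ).prod :=
  Commute.list_prod_left _ _ fun _ h => by
    obtain ⟨i, -, rfl⟩ := List.mem_map.1 h
    refine Commute.list_prod_right _ _ fun _ h => ?_
    obtain ⟨j, -, rfl⟩ := List.mem_map.1 h
    exact x_mul_θ i j

theorem word_mul_word {m n p q : ℕ} (a : Fin m → ℕ+) (b : Fin n → ℕ+) (a' : Fin q → ℕ+)
    (b' : Fin p → ℕ+) : word a b * word a' b' = word (Fin.append a a') (Fin.append b b') := by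
  have h := (prod_x_mul_θ (List.ofFn b) (List.ofFn a')).eq
  have e : ∀ {k : ℕ} (f : ℕ+ → SSeries) (c : Fin k → ℕ+),
      List.ofFn (fun i => f (c i)) = (List.ofFn c).map f := fun f c => (List.map_ofFn ..).symm
  simp only [word, e, List.ofFn_fin_append, List.map_append, List.prod_append]
  simp only [mul_assoc]
  rw [← mul_assoc _ _ (List.prod (List.map x (List.ofFn b'))), h]
  simp only [mul_assoc]

/-- The sum `wordSum c` restricted to words over the finite alphabet `V`. -/
def wordSumOn {m n : ℕ} (V : Finset ℕ+) (c : (Fin m → ℕ+) → (Fin n → ℕ+) → ℚ) : SSeries :=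
  ∑ a ∈ Fintype.piFinset fun _ => V, ∑ b ∈ Fintype.piFinset fun _ => V, c a b • word a b

theorem coeff_wordSum {m n : ℕ} (c : (Fin m → ℕ+) → (Fin n → ℕ+) → ℚ) (S w) :
    (wordSum c).coeff S w =
      ∑ᶠ t : (Fin m → ℕ+) × (Fin n → ℕ+), c t.1 t.2 * (word t.1 t.2).coeff S w := rfl

/-- A word contributes at `(S, w)` only if its `θ`-letters form the set `S` and its `x`-letters
spell `w`. Any alphabet containing these letters therefore sees all contributions, which reduces
infinite sums to finite ones. -/
theorem coeff_wordSumOn {m n : ℕ} {V : Finset ℕ+} (c : (Fin m → ℕ+) → (Fin n → ℕ+) → ℚ) {S w}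
    (hS : S ⊆ V) (hw : ∀ i ∈ w, i ∈ V) :
    (wordSumOn V c).coeff S w = (wordSum c).coeff S w := by
  change coeffHom S w _ = _
  simp only [wordSumOn, map_sum, map_smul]
  rw [← Finset.sum_product', coeff_wordSum]
  refine (finsum_eq_sum_of_support_subset _ ?_).symm
  rintro ⟨a, b⟩ h
  obtain ⟨rfl, rfl⟩ := coeff_word_ne_zero (right_ne_zero_of_mul h)
  simp only [Finset.coe_product, Set.mem_prod, Finset.mem_coe, Fintype.mem_piFinset]
  exact ⟨fun i => hS (Finset.mem_image_of_mem _ (Finset.mem_univ i)),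
    fun i => hw _ ((List.mem_ofFn' b _).2 ⟨i, rfl⟩)⟩

theorem sum_piFinset_append {m k : ℕ} {M : Type*} [AddCommMonoid M] (V : Finset ℕ+)
    (f : (Fin (m + k) → ℕ+) → M) :
    ∑ a ∈ Fintype.piFinset (fun _ => V), f a =
      ∑ a ∈ Fintype.piFinset (fun _ => V), ∑ a' ∈ Fintype.piFinset (fun _ => V),
        f (Fin.append a a') := by
  rw [← Finset.sum_product']
  refine (Finset.sum_equiv (Fin.appendEquiv m k) ?_ ?_).symm
  · rintro ⟨a, a'⟩
    simp only [Finset.mem_product, Fintype.mem_piFinset, Fin.appendEquiv, Equiv.coe_fn_mk]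
    constructor
    · rintro ⟨h, h'⟩ i
      refine Fin.addCases (fun i => ?_) (fun i => ?_) i
      · simpa using h i
      · simpa using h' i
    · intro h
      exact ⟨fun i => by simpa using h (Fin.castAdd k i), fun i => by simpa using h (Fin.natAdd m i)⟩
  · rintro ⟨a, a'⟩ -
    rfl

theorem wordSumOn_mul_wordSumOn {m n p q : ℕ} (V : Finset ℕ+)
    (c : (Fin m → ℕ+) → (Fin n → ℕ+) → ℚ) (d : (Fin q → ℕ+) → (Fin p → ℕ+) → ℚ) :
    wordSumOn V c * wordSumOn V d =
      wordSumOn V fun a b => c (a ∘ Fin.castAdd q) (b ∘ Fin.castAdd p) *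
        d (a ∘ Fin.natAdd m) (b ∘ Fin.natAdd n) := by
  unfold wordSumOn
  rw [sum_piFinset_append, Finset.sum_mul_sum]
  refine Finset.sum_congr rfl fun a _ => Finset.sum_congr rfl fun a' _ => ?_
  rw [sum_piFinset_append, Finset.sum_mul_sum]
  refine Finset.sum_congr rfl fun b _ => Finset.sum_congr rfl fun b' _ => ?_
  rw [smul_mul_smul_comm, word_mul_word]
  congr 2
  · congr 1 <;> funext i <;> simp
  · congr 1 <;> funext i <;> simp

theorem wordSum_mul_wordSum {m n p q : ℕ}
    (c : (Fin m → ℕ+) → (Fin n → ℕ+) → ℚ) (d : (Fin q → ℕ+) → (Fin p → ℕ+) → ℚ) :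
    wordSum c * wordSum d =
      wordSum fun a b => c (a ∘ Fin.castAdd q) (b ∘ Fin.castAdd p) *
        d (a ∘ Fin.natAdd m) (b ∘ Fin.natAdd n) := by
  ext S w
  -- The coefficient of the product at `(S, w)` involves the factors only at subsets of `S` and at
  -- initial or final segments of `w`, so the single alphabet `S ∪ w.toFinset` serves the product
  -- and both factors.
  have hS : S ⊆ S ∪ w.toFinset := Finset.subset_union_left
  have hw : ∀ i ∈ w, i ∈ S ∪ w.toFinset := fun i hi =>
    Finset.mem_union_right _ (List.mem_toFinset.2 hi)
  rw [← coeff_wordSumOn _ hS hw, ← wordSumOn_mul_wordSumOn, coeff_mul, coeff_mul]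
  refine Finset.sum_congr rfl fun T hT => Finset.sum_congr rfl fun i _ => ?_
  rw [coeff_wordSumOn _ ((Finset.mem_powerset.1 hT).trans hS)
      fun i hi => hw i (List.mem_of_mem_take hi),
    coeff_wordSumOn _ (Finset.sdiff_subset.trans hS) fun i hi => hw i (List.mem_of_mem_drop hi)]

/-! ### Comparison and cancellation of formal sums -/

theorem wordSum_congr {m n : ℕ} {c d : (Fin m → ℕ+) → (Fin n → ℕ+) → ℚ}
    (h : ∀ a, Function.Injective a → ∀ b, c a b = d a b) : wordSum c = wordSum d := by
  ext S w
  rw [coeff_wordSum, coeff_wordSum]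
  refine finsum_congr fun t => ?_
  by_cases ht : Function.Injective t.1
  · rw [h _ ht]
  · rw [word_eq_zero ht, coeff_zero, mul_zero, mul_zero]

theorem wordSum_add {m n : ℕ} (c d : (Fin m → ℕ+) → (Fin n → ℕ+) → ℚ) :
    wordSum (fun a b => c a b + d a b) = wordSum c + wordSum d := by
  ext S w
  simp only [coeff_add, coeff_wordSum, add_mul]
  exact finsum_add_distrib (finite_support_word c S w) (finite_support_word d S w)

/-- The sum vanishes if an involution of the words preserves coefficients and negates monomials. -/
theorem wordSum_eq_zero {m n : ℕ} {c : (Fin m → ℕ+) → (Fin n → ℕ+) → ℚ}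
    {σ : (Fin m → ℕ+) × (Fin n → ℕ+) → (Fin m → ℕ+) × (Fin n → ℕ+)}
    (hσ : Function.Involutive σ)
    (h : ∀ t, c (σ t).1 (σ t).2 • word (σ t).1 (σ t).2 = -(c t.1 t.2 • word t.1 t.2)) :
    wordSum c = 0 := by
  ext S w
  rw [coeff_wordSum, coeff_zero]
  -- Reindexing along `σ` turns the sum into its own negative, and this forces a rational number to
  -- be zero.
  refine self_eq_neg.1 ?_
  rw [← finsum_neg_distrib, ← finsum_comp_equiv hσ.toPerm]
  refine finsum_congr fun t => ?_
  exact (congrArg (coeffHom S w) (h t)).trans (map_neg _ _)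

end SSeries

end Superspace

namespace Superspace

/-! ### Blocks of an over product -/

theorem shift_injective (r : ℕ) : Function.Injective fun j : ℕ => if j = 0 then 0 else j + r := by
  intro i j h
  simp only at h
  split_ifs at h <;> omega

theorem card_shift (r : ℕ) (A : Finset ℕ) : (shift r A).card = A.card :=
  Finset.card_image_of_injective _ (shift_injective r)

namespace SetSupercomp

variable {n m p q : ℕ}

/-- The blocks are those of `K` and the shifted ones of `L` in another order, and shifting is
injective, so it preserves block sizes. -/
theorem blockFactorial_overProduct (K : SetSupercomp n m) (L : SetSupercomp p q) :
    (K.overProduct L).blockFactorial = K.blockFactorial * L.blockFactorial := by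
  have e : List.ofFn (fun i => shift n (L.ferm i)) = (List.ofFn L.ferm).map (shift n) :=
    (List.map_ofFn ..).symm
  simp only [blockFactorial, blocks, overProduct, List.ofFn_fin_append, e, List.map_append,
    List.prod_append, List.map_map, Function.comp_def, card_shift]
  ring

theorem mem_blocks_overProduct {K : SetSupercomp n m} {L : SetSupercomp p q} {B : Finset ℕ} :
    B ∈ (K.overProduct L).blocks ↔ B ∈ K.blocks ∨ ∃ C ∈ L.blocks, shift n C = B := by
  have e : List.ofFn (fun i => shift n (L.ferm i)) = (List.ofFn L.ferm).map (shift n) :=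
    (List.map_ofFn ..).symm
  simp only [blocks, overProduct, List.ofFn_fin_append, e, List.mem_append, List.mem_map]
  grind

/-- The element `0` has to be excluded: it may lie in fermionic blocks coming from both factors. -/
theorem sameBlock_overProduct {K : SetSupercomp n m} {L : SetSupercomp p q} {i j : ℕ}
    (hi : i ≠ 0) (hj : j ≠ 0) : (K.overProduct L).SameBlock i j ↔
      K.SameBlock i j ∨ n < i ∧ n < j ∧ L.SameBlock (i - n) (j - n) := by
  simp only [SameBlock, mem_blocks_overProduct]
  constructor
  · rintro ⟨B, hB | ⟨C, hC, rfl⟩, h1, h2⟩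
    · exact Or.inl ⟨B, hB, h1, h2⟩
    · rw [mem_shift hi] at h1
      rw [mem_shift hj] at h2
      exact Or.inr ⟨h1.1, h2.1, C, hC, h1.2, h2.2⟩
  · rintro (⟨B, hB, h⟩ | ⟨h1, h2, C, hC, h3, h4⟩)
    · exact ⟨B, Or.inl hB, h⟩
    · exact ⟨_, Or.inr ⟨C, hC, rfl⟩, (mem_shift hi).2 ⟨h1, h3⟩, (mem_shift hj).2 ⟨h2, h4⟩⟩

theorem SameBlock.le {K : SetSupercomp n m} {i j : ℕ} (h : K.SameBlock i j) : i ≤ n ∧ j ≤ n := by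
  obtain ⟨B, hB, hi, hj⟩ := h
  exact ⟨le_of_mem hB hi, le_of_mem hB hj⟩

section Indices

variable (K : SetSupercomp n m) (L : SetSupercomp p q)

theorem sameBlock_castAdd_castAdd (i j : Fin n) :
    (K.overProduct L).SameBlock (Fin.castAdd p i + 1) (Fin.castAdd p j + 1) ↔
      K.SameBlock (i + 1) (j + 1) := by
  rw [sameBlock_overProduct (by simp) (by simp)]
  simp only [Fin.val_castAdd]
  have := i.2
  exact or_iff_left (by omega)

theorem sameBlock_castAdd_natAdd (i : Fin n) (j : Fin p) :
    ¬ (K.overProduct L).SameBlock (Fin.castAdd p i + 1) (Fin.natAdd n j + 1) := by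
  rw [sameBlock_overProduct (by simp) (by simp)]
  simp only [Fin.val_castAdd, Fin.val_natAdd]
  have := i.2
  rintro (h | h)
  · have := h.le
    omega
  · omega

theorem sameBlock_natAdd_castAdd (i : Fin p) (j : Fin n) :
    ¬ (K.overProduct L).SameBlock (Fin.natAdd n i + 1) (Fin.castAdd p j + 1) :=
  fun h => sameBlock_castAdd_natAdd K L j i h.symm

theorem sameBlock_natAdd_natAdd (i j : Fin p) :
    (K.overProduct L).SameBlock (Fin.natAdd n i + 1) (Fin.natAdd n j + 1) ↔
      L.SameBlock (i + 1) (j + 1) := by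
  rw [sameBlock_overProduct (by simp) (by simp)]
  simp only [Fin.val_natAdd]
  -- The index `k : Fin p` stands for the element `k + 1`, which the shift moves to `n + k + 1`.
  have e : ∀ k : ℕ, n + k + 1 - n = k + 1 := fun k => by omega
  rw [e, e]
  constructor
  · rintro (h | h)
    · have := h.le
      omega
    · exact h.2.2
  · exact fun h => Or.inr ⟨by omega, by omega, h⟩

theorem overProduct_ferm_castAdd (i : Fin m) :
    (K.overProduct L).ferm (Fin.castAdd q i) = K.ferm i :=
  Fin.append_left K.ferm (fun i => shift n (L.ferm i)) i

theorem overProduct_ferm_natAdd (i : Fin q) :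
    (K.overProduct L).ferm (Fin.natAdd m i) = shift n (L.ferm i) :=
  Fin.append_right K.ferm (fun i => shift n (L.ferm i)) i

theorem castAdd_mem_ferm_castAdd (j : Fin n) (i : Fin m) :
    (Fin.castAdd p j : ℕ) + 1 ∈ (K.overProduct L).ferm (Fin.castAdd q i) ↔
      (j : ℕ) + 1 ∈ K.ferm i := by
  rw [overProduct_ferm_castAdd, Fin.val_castAdd]

theorem natAdd_mem_ferm_castAdd (j : Fin p) (i : Fin m) :
    (Fin.natAdd n j : ℕ) + 1 ∉ (K.overProduct L).ferm (Fin.castAdd q i) := by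
  rw [overProduct_ferm_castAdd, Fin.val_natAdd]
  intro h
  have := le_of_mem (mem_blocks.2 (Or.inl ⟨i, rfl⟩)) h
  omega

theorem castAdd_mem_ferm_natAdd (j : Fin n) (i : Fin q) :
    (Fin.castAdd p j : ℕ) + 1 ∉ (K.overProduct L).ferm (Fin.natAdd m i) := by
  rw [overProduct_ferm_natAdd, mem_shift (by simp), Fin.val_castAdd]
  have := j.2
  omega

theorem natAdd_mem_ferm_natAdd (j : Fin p) (i : Fin q) :
    (Fin.natAdd n j : ℕ) + 1 ∈ (K.overProduct L).ferm (Fin.natAdd m i) ↔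
      (j : ℕ) + 1 ∈ L.ferm i := by
  rw [overProduct_ferm_natAdd, mem_shift (by simp), Fin.val_natAdd,
    show n + j + 1 - n = (j : ℕ) + 1 by omega]
  exact and_iff_right (by omega)

end Indices

theorem forall_fin_add {k l : ℕ} {P : Fin (k + l) → Prop} :
    (∀ i, P i) ↔ (∀ i, P (Fin.castAdd l i)) ∧ ∀ i, P (Fin.natAdd k i) :=
  ⟨fun h => ⟨fun _ => h _, fun _ => h _⟩, fun h i => Fin.addCases h.1 h.2 i⟩

/-- Splitting both index ranges gives four kinds of clauses. The mixed ones are vacuous, since no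
block has nonzero elements in both halves. -/
theorem powerCond_overProduct {K : SetSupercomp n m} {L : SetSupercomp p q}
    {a : Fin (m + q) → ℕ+} {b : Fin (n + p) → ℕ+} : (K.overProduct L).PowerCond a b ↔
      K.PowerCond (a ∘ Fin.castAdd q) (b ∘ Fin.castAdd p) ∧
        L.PowerCond (a ∘ Fin.natAdd m) (b ∘ Fin.natAdd n) := by
  simp only [PowerCond, forall_fin_add, castAdd_mem_ferm_castAdd, natAdd_mem_ferm_castAdd,
    castAdd_mem_ferm_natAdd, natAdd_mem_ferm_natAdd, sameBlock_castAdd_castAdd,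
    sameBlock_castAdd_natAdd, sameBlock_natAdd_castAdd, sameBlock_natAdd_natAdd,
    Function.comp_apply, false_imp_iff, implies_true, and_true, true_and]
  exact and_and_and_comm

theorem elemCond_overProduct {K : SetSupercomp n m} {L : SetSupercomp p q}
    {a : Fin (m + q) → ℕ+} {b : Fin (n + p) → ℕ+} : (K.overProduct L).ElemCond a b ↔
      K.ElemCond (a ∘ Fin.castAdd q) (b ∘ Fin.castAdd p) ∧
        L.ElemCond (a ∘ Fin.natAdd m) (b ∘ Fin.natAdd n) := by
  simp only [ElemCond, forall_fin_add, castAdd_mem_ferm_castAdd, natAdd_mem_ferm_castAdd,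
    castAdd_mem_ferm_natAdd, natAdd_mem_ferm_natAdd, sameBlock_castAdd_castAdd,
    sameBlock_castAdd_natAdd, sameBlock_natAdd_castAdd, sameBlock_natAdd_natAdd,
    Function.comp_apply, false_imp_iff, implies_true, and_true, true_and, ne_eq,
    (Fin.castAdd_injective n p).eq_iff, (Fin.natAdd_injective p n).eq_iff]
  exact and_and_and_comm

/-! ### Meets and the multiplicativity of the factorial coefficient -/

theorem sameBlock_inf {K L : SetSupercomp n m} {i j : ℕ} (hi : i ≠ 0) (hj : j ≠ 0) :
    (K ⊓ L).SameBlock i j ↔ K.SameBlock i j ∧ L.SameBlock i j := by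
  refine ⟨fun h => ⟨(le_iff.1 inf_le_left).2 i j hi hj h, (le_iff.1 inf_le_right).2 i j hi hj h⟩,
    fun ⟨hK, hL⟩ => (sameBlock_ofColor ..).2 ?_⟩
  obtain ⟨hin, hjn⟩ := hK.le
  by_cases hc : ∃ k, i ∈ K.ferm k ∩ L.ferm k
  · obtain ⟨k, hk⟩ := hc
    have hk' := Finset.mem_inter.1 hk
    exact Or.inl ⟨k, hk, Finset.mem_inter.2 ⟨hK.mem_ferm hi hk'.1, hL.mem_ferm hi hk'.2⟩⟩
  -- Here `i` lies in no common fermionic block; this includes the case of fermionic blocks of `K`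
  -- and `L` with different indices. Then `j` lies in none either, and the two elements share a
  -- nonfermionic block of the meet, being coloured by the same pair of blocks.
  · push Not at hc
    refine Or.inr ⟨mem_rest.2 ⟨⟨by omega, hin⟩, hc⟩, mem_rest.2 ⟨⟨by omega, hjn⟩, fun k hk => ?_⟩,
      Prod.ext ((sameBlock_iff_blockOf hi hj hin).1 hK) ((sameBlock_iff_blockOf hi hj hin).1 hL)⟩
    have hk' := Finset.mem_inter.1 hk
    exact hc k (Finset.mem_inter.2 ⟨hK.symm.mem_ferm hj hk'.1, hL.symm.mem_ferm hj hk'.2⟩)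

theorem inf_ferm (K L : SetSupercomp n m) (i : Fin m) : (K ⊓ L).ferm i = K.ferm i ∩ L.ferm i := rfl

theorem ext_fin {K L : SetSupercomp n m}
    (hF : ∀ (i : Fin m) (j : Fin n), (j : ℕ) + 1 ∈ K.ferm i ↔ (j : ℕ) + 1 ∈ L.ferm i)
    (h : ∀ i j : Fin n, K.SameBlock (i + 1) (j + 1) ↔ L.SameBlock (i + 1) (j + 1)) : K = L := by
  have hex : ∀ j : ℕ, j ≠ 0 → j ≤ n → ∃ k : Fin n, j = k + 1 := fun j h0 hj =>
    ⟨⟨j - 1, by omega⟩, by simp only; omega⟩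
  refine ext_of_sameBlock (funext fun i => Finset.ext fun j => ?_) fun i j hi hj hin hjn => ?_
  · by_cases h0 : j = 0
    · subst h0
      exact iff_of_true (K.zero_mem_ferm i) (L.zero_mem_ferm i)
    · by_cases hj : j ≤ n
      · obtain ⟨k, rfl⟩ := hex j h0 hj
        exact hF i k
      · exact iff_of_false (fun h => hj (le_of_mem (mem_blocks.2 (Or.inl ⟨i, rfl⟩)) h))
          fun h => hj (le_of_mem (mem_blocks.2 (Or.inl ⟨i, rfl⟩)) h)
  · obtain ⟨k, rfl⟩ := hex i hi hin
    obtain ⟨l, rfl⟩ := hex j hj hjn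
    exact h k l

/-- The type `N` of the whole word may join elements of the two halves, when these share letters,
but the over product joins none, so the meet forgets such coincidences. Within one half, `N` and the
type of that half record the same equalities of letters. -/
theorem overProduct_inf {K L : SetSupercomp n m} {K' L' : SetSupercomp p q}
    {N : SetSupercomp (n + p) (m + q)} {a : Fin (m + q) → ℕ+} {b : Fin (n + p) → ℕ+}
    (hN : N.MonomialCond a b) (hL : L.MonomialCond (a ∘ Fin.castAdd q) (b ∘ Fin.castAdd p))
    (hL' : L'.MonomialCond (a ∘ Fin.natAdd m) (b ∘ Fin.natAdd n)) :
    K.overProduct K' ⊓ N = (K ⊓ L).overProduct (K' ⊓ L') := by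
  refine ext_fin ?_ ?_
  · simp only [inf_ferm, Finset.mem_inter, forall_fin_add, castAdd_mem_ferm_castAdd,
      natAdd_mem_ferm_castAdd, castAdd_mem_ferm_natAdd, natAdd_mem_ferm_natAdd, ← hN.1, ← hL.1,
      ← hL'.1, Function.comp_apply, false_and, implies_true, and_self]
  · simp only [sameBlock_inf (Nat.succ_ne_zero _) (Nat.succ_ne_zero _), forall_fin_add,
      sameBlock_castAdd_castAdd, sameBlock_castAdd_natAdd, sameBlock_natAdd_castAdd,
      sameBlock_natAdd_natAdd, ← hN.2, ← hL.2, ← hL'.2, Function.comp_apply, false_and,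
      implies_true, and_self]

open Classical in
/-- The coefficient `(K ⊓ L)!` of a monomial in `M(L)`, and zero if `a` is not injective. -/
noncomputable def meetCoeff (K : SetSupercomp n m) (a : Fin m → ℕ+) (b : Fin n → ℕ+) : ℚ :=
  if h : Function.Injective a then ((K ⊓ monomialType a b h).blockFactorial : ℚ) else 0

theorem MonomialCond.meetCoeff_eq {K L : SetSupercomp n m} {a : Fin m → ℕ+} {b : Fin n → ℕ+}
    (hL : L.MonomialCond a b) (ha : Function.Injective a) :
    K.meetCoeff a b = ((K ⊓ L).blockFactorial : ℚ) := by
  rw [meetCoeff, dif_pos ha, (monomialCond_monomialType a b ha).eq hL]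

/-- Injectivity of `a` cannot be dropped: if the two halves are injective but share a letter, the
left side is zero and the right side is positive. -/
theorem meetCoeff_overProduct (K : SetSupercomp n m) (L : SetSupercomp p q)
    {a : Fin (m + q) → ℕ+} (ha : Function.Injective a) (b : Fin (n + p) → ℕ+) :
    (K.overProduct L).meetCoeff a b =
      K.meetCoeff (a ∘ Fin.castAdd q) (b ∘ Fin.castAdd p) *
        L.meetCoeff (a ∘ Fin.natAdd m) (b ∘ Fin.natAdd n) := by
  have h1 := monomialCond_monomialType _ (b ∘ Fin.castAdd p) (ha.comp (Fin.castAdd_injective m q))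
  have h2 := monomialCond_monomialType _ (b ∘ Fin.natAdd n) (ha.comp (Fin.natAdd_injective q m))
  have h := monomialCond_monomialType a b ha
  rw [h.meetCoeff_eq ha, h1.meetCoeff_eq (ha.comp (Fin.castAdd_injective m q)),
    h2.meetCoeff_eq (ha.comp (Fin.natAdd_injective q m)), overProduct_inf h h1 h2,
    blockFactorial_overProduct, Nat.cast_mul]

/-- The type of a word depends only on which equalities `a i = b j` and `b i = b j` hold. Exchanging
two letters absent from `b` affects none of them. -/
theorem meetCoeff_swap_comp (K : SetSupercomp n m) (a : Fin m → ℕ+) {b : Fin n → ℕ+} {u v : ℕ+}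
    (hu : ∀ j, b j ≠ u) (hv : ∀ j, b j ≠ v) :
    K.meetCoeff (Equiv.swap u v ∘ a) b = K.meetCoeff a b := by
  have hinj : Function.Injective (Equiv.swap u v ∘ a) ↔ Function.Injective a :=
    (Equiv.swap u v).injective.of_comp_iff a
  by_cases ha : Function.Injective a
  · have h := monomialCond_monomialType a b ha
    rw [h.meetCoeff_eq ha]
    refine MonomialCond.meetCoeff_eq ⟨fun i j => ?_, h.2⟩ (hinj.2 ha)
    rw [← h.1, Function.comp_apply, Equiv.swap_apply_eq_iff,
      Equiv.swap_apply_of_ne_of_ne (hu j) (hv j)]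
  · rw [meetCoeff, meetCoeff, dif_neg ha, dif_neg (mt hinj.1 ha)]

end SetSupercomp

end Superspace

namespace Superspace

namespace SetSupercomp

variable {n m p q : ℕ}

/-! ### Cancellation of the null-symmetric words -/

/-- The values `a_i` that do not occur among the `b_j`. -/
def freeValues (a : Fin m → ℕ+) (b : Fin n → ℕ+) : Finset ℕ+ :=
  Finset.univ.image a \ Finset.univ.image b

theorem mem_freeValues {a : Fin m → ℕ+} {b : Fin n → ℕ+} {u : ℕ+} :
    u ∈ freeValues a b ↔ (∃ i, a i = u) ∧ ∀ j, b j ≠ u := by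
  simp [freeValues]

theorem freeValues_swap_comp {a : Fin m → ℕ+} {b : Fin n → ℕ+} {u v : ℕ+}
    (hu : u ∈ freeValues a b) (hv : v ∈ freeValues a b) :
    freeValues (Equiv.swap u v ∘ a) b = freeValues a b := by
  obtain ⟨⟨i, rfl⟩, -⟩ := mem_freeValues.1 hu
  obtain ⟨⟨j, rfl⟩, -⟩ := mem_freeValues.1 hv
  ext w
  simp only [mem_freeValues, Function.comp_apply, Equiv.swap_apply_eq_iff]
  refine and_congr_left fun _ => ?_
  by_cases h1 : w = a i
  · simp [h1]
  · by_cases h2 : w = a j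
    · simp [h2]
    · rw [Equiv.swap_apply_of_ne_of_ne h1 h2]

open Classical in
/-- The swap of the extreme free values of a null-symmetric monomial. -/
noncomputable def nullSwap (t : (Fin m → ℕ+) × (Fin n → ℕ+)) : (Fin m → ℕ+) × (Fin n → ℕ+) :=
  if h : (freeValues t.1 t.2).Nonempty then
    (Equiv.swap ((freeValues t.1 t.2).min' h) ((freeValues t.1 t.2).max' h) ∘ t.1, t.2)
  else t

theorem nullSwap_of_nonempty {a : Fin m → ℕ+} {b : Fin n → ℕ+} (h : (freeValues a b).Nonempty) :
    nullSwap (a, b) =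
      (Equiv.swap ((freeValues a b).min' h) ((freeValues a b).max' h) ∘ a, b) := dif_pos h

theorem freeValues_nullSwap (a : Fin m → ℕ+) (b : Fin n → ℕ+) :
    freeValues (nullSwap (a, b)).1 b = freeValues a b := by
  by_cases h : (freeValues a b).Nonempty
  · rw [nullSwap_of_nonempty h, freeValues_swap_comp (Finset.min'_mem _ _) (Finset.max'_mem _ _)]
  · rw [nullSwap, dif_neg h]

/-- The two exchanged letters are determined by the set of free values alone, and the exchange
preserves this set. A second application therefore exchanges the same two letters back. -/
theorem nullSwap_involutive : Function.Involutive (nullSwap (m := m) (n := n)) := by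
  rintro ⟨a, b⟩
  by_cases h : (freeValues a b).Nonempty
  · have e := freeValues_swap_comp (Finset.min'_mem _ h) (Finset.max'_mem _ h)
    rw [nullSwap_of_nonempty h, nullSwap_of_nonempty (e.symm ▸ h)]
    simp only [e, ← Function.comp_assoc]
    congr 1
    funext i
    simp
  · have e : nullSwap (a, b) = (a, b) := dif_neg h
    rw [e, e]

open Classical in
/-- The null-symmetric monomials cancel. -/
theorem wordSum_nullSymmetric (K : SetSupercomp n m) :
    SSeries.wordSum (fun a b => if NullSymmetric a b then K.meetCoeff a b else 0) = 0 := by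
  refine SSeries.wordSum_eq_zero nullSwap_involutive ?_
  rintro ⟨a, b⟩
  have e := freeValues_nullSwap a b
  by_cases hN : NullSymmetric a b
  · have hcard : 1 < (freeValues a b).card := hN
    have hne : (freeValues a b).Nonempty := Finset.card_pos.1 (by omega)
    rw [nullSwap_of_nonempty hne] at e ⊢
    have hN' : NullSymmetric (Equiv.swap ((freeValues a b).min' hne)
        ((freeValues a b).max' hne) ∘ a) b := by
      change 1 < (freeValues _ b).card
      rwa [e]
    -- With at least two free values the exchanged letters differ, so the word really changes sign.
    have hlt := Finset.min'_lt_max'_of_card _ hcard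
    obtain ⟨⟨i, hi⟩, hu⟩ := mem_freeValues.1 (Finset.min'_mem _ hne)
    obtain ⟨⟨j, hj⟩, hv⟩ := mem_freeValues.1 (Finset.max'_mem _ hne)
    simp only [if_pos hN, if_pos hN']
    rw [meetCoeff_swap_comp K a hu hv, ← smul_neg]
    by_cases ha : Function.Injective a
    · rw [← hi, ← hj, SSeries.word_swap_comp ha]
      rintro rfl
      exact hlt.ne (hi.symm.trans hj)
    -- For noninjective `a` the coefficient is zero by convention.
    · rw [meetCoeff, dif_neg ha, zero_smul, zero_smul]
  -- Being null-symmetric depends only on the set of free values, so the image is not null-symmetric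
  -- either and both coefficients vanish.
  · have h2 : (nullSwap (a, b)).2 = b := by
      rw [nullSwap]
      split_ifs <;> rfl
    have hN' : ¬ NullSymmetric (nullSwap (a, b)).1 (nullSwap (a, b)).2 := by
      rw [h2]
      change ¬ 1 < (freeValues _ b).card
      rwa [e]
    simp only [if_neg hN, if_neg hN', zero_smul, neg_zero]

/-- Adding the vanishing sum over null-symmetric words removes the one condition in the definition
of `h` that is incompatible with concatenation. -/
theorem complete_eq_wordSum (K : SetSupercomp n m) :
    K.complete = SSeries.wordSum K.meetCoeff := by
  classical
  rw [← add_zero K.complete, ← wordSum_nullSymmetric K, complete, ← SSeries.wordSum_add]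
  refine SSeries.wordSum_congr fun a ha b => ?_
  by_cases h : NullSymmetric a b
  · rw [dif_neg (fun hh => hh.2 h), if_pos h, zero_add]
  · rw [dif_pos ⟨ha, h⟩, if_neg h, add_zero, meetCoeff, dif_pos ha]

/-! ### The three product formulas -/

theorem powerSum_mul_powerSum (K : SetSupercomp n m) (L : SetSupercomp p q) :
    K.powerSum * L.powerSum = (K.overProduct L).powerSum := by
  classical
  rw [powerSum, powerSum, powerSum, SSeries.wordSum_mul_wordSum]
  simp only [powerCond_overProduct, ite_and, ite_mul, one_mul, zero_mul]

theorem elementary_mul_elementary (K : SetSupercomp n m) (L : SetSupercomp p q) :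
    K.elementary * L.elementary = (K.overProduct L).elementary := by
  classical
  rw [elementary, elementary, elementary, SSeries.wordSum_mul_wordSum]
  simp only [elemCond_overProduct, ite_and, ite_mul, one_mul, zero_mul]

theorem complete_mul_complete (K : SetSupercomp n m) (L : SetSupercomp p q) :
    K.complete * L.complete = (K.overProduct L).complete := by
  rw [complete_eq_wordSum, complete_eq_wordSum, complete_eq_wordSum, SSeries.wordSum_mul_wordSum]
  -- The coefficients agree only at injective `a`, which suffices because all other words are zero.
  exact SSeries.wordSum_congr fun a ha b => (meetCoeff_overProduct K L ha b).symm

end SetSupercomp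

end Superspace

theorem mainTheorem5 {n m p q : ℕ}
    (I : Superspace.SetSupercomp n m) (J : Superspace.SetSupercomp p q)
    (hI : I.IsSuperpartition) (hJ : J.IsSuperpartition) :
    I.powerSum * J.powerSum = (I.overProduct J).powerSum ∧
      I.elementary * J.elementary = (I.overProduct J).elementary ∧
      I.complete * J.complete = (I.overProduct J).complete :=
  ⟨I.powerSum_mul_powerSum J, I.elementary_mul_elementary J, I.complete_mul_complete J⟩
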